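/- Let $\mathfrak A$ be a (not necessarily unital) $C^*$-algebra with a faithful $*$-representation $\pi:\mathfrak A\to\mathcal B(\mathcal H)$ on a Hilbert space, let $\mathcal H_0,\mathcal H_1,\mathcal H_2$ be Hilbert spaces, let $\mathcal V_l:\mathcal H_l\to\mathcal H$ ($l=1,2$) be unitary, and let $A_l$ be (unbounded) self-adjoint operators in $\mathcal H_l$ with $(A_lu,u)\ge\lambda_{0l}\|u\|^2$ on $\mathrm{Dom}(A_l)$, where $\lambda_{0l}\le 0$. Assume that $\mathcal V_le^{-tA_l}\mathcal V_l^{-1}\in\pi(\mathfrak A)$ for all $t>0$ and that there is a faithful normal semi-finite trace on the von Neumann algebra $\pi(\mathfrak A)''$ which is finite on all the operators $\mathcal V_le^{-tA_l}\mathcal V_l^{-1}$, $t>0$, $l=1,2$. Let $i_l:\mathcal H_0\to\mathcal H_l$ be injective bounded linear maps, $p_l:\mathcal H_l\to\mathcal H_0$ bounded linear maps with $p_li_l=\mathrm{id}$, and $J$ a bounded self-adjoint operator in $\mathcal H_0$, such that $\mathcal V_2i_2Jp_1\mathcal V_1^{-1}\in\pi(\mathfrak A)''$, $(i_2Jp_1)^*=i_1Jp_2$,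 and $\pi(a)\mathcal V_2i_2Jp_1\mathcal V_1^{-1}\in\pi(\mathfrak A)$ for all $a\in\mathfrak A$. Let $\rho>1$ satisfy $\rho^{-1}\|i_2Ju\|\le\|i_1Ju\|\le\rho\|i_2Ju\|$ for all $u\in\mathcal H_0$. Put $J_l=i_lJp_l$ and assume that $J_l$ is self-adjoint, $0\le J_l\le\mathrm{id}$, $J_l$ maps $\mathrm{Dom}(A_l)$ to itself, and, for $u\in\mathcal H_0$, $i_1Ju\in\mathrm{Dom}(A_1)$ if and only if $i_2Ju\in\mathrm{Dom}(A_2)$; let $D$ be the set of these $u$. Let $J_l'=(\mathrm{id}-J_l^2)^{1/2}$ and assume that $J_l'$ maps $\mathrm{Dom}(A_l)$ to itself and that $[J_l,[J_l,A_l]]$ and $[J_l',[J_l',A_l]]$, defined on $\mathrm{Dom}(A_l)$, extend to bounded operators of norm at most $\gamma_l$. Finally assume, with some $\alpha_l>0$, $\beta_l\ge1$, $\varepsilon_l>0$, that $$(A_lJ_l'u,J_l'u)\ge\alpha_l\|J_l'u\|^2\quad (u\in\mathrm{Dom}(A_l),\ l=1,2),$$ $$(A_2i_2Ju,i_2Ju)\le\beta_1(A_1i_1Ju,i_1Ju)+\varepsilon_1\|i_1Ju\|^2\quad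 (u\in D),$$ $$(A_1i_1Ju,i_1Ju)\le\beta_2(A_2i_2Ju,i_2Ju)+\varepsilon_2\|i_2Ju\|^2\quad (u\in D).$$ Let $a_1<b_1$ and $$a_2=\rho\left[\beta_1\left(a_1+\gamma_1+\frac{(a_1+\gamma_1-\lambda_{01})^2}{\alpha_1-a_1-\gamma_1}\right)+\varepsilon_1\right],$$ $$b_2=\frac{\beta_2^{-1}(b_1\rho^{-1}-\varepsilon_2)(\alpha_2-\gamma_2)-\alpha_2\gamma_2+2\lambda_{02}\gamma_2-\lambda_{02}^2}{\alpha_2-2\lambda_{02}+\beta_2^{-1}(b_1\rho^{-1}-\varepsilon_2)},$$ and suppose that $\alpha_1>a_1+\gamma_1$, $\alpha_2>b_2+\gamma_2$ and $b_2>a_2\ge0$. If $(a_1,b_1)$ does not intersect the spectrum of $A_1$, then: (1) $(a_2,b_2)$ does not intersect the spectrum of $A_2$; (2) for all $\lambda_1\in(a_1,b_1)$ and $\lambda_2\in(a_2,b_2)$, the projections $\mathcal V_1E_1(\lambda_1)\mathcal V_1^{-1}$ and $\mathcal V_2E_2(\lambda_2)\mathcal V_2^{-1}$, where $E_l(\lambda)$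 is the spectral projection of $A_l$ for $(-\infty,\lambda]$, belong to $\pi(\mathfrak A)\cong\mathfrak A$ and are Murray–von Neumann equivalent in $\mathfrak A$: they are the images of $v^*v$ and $vv^*$ for some $v\in\mathfrak A$. -/

import Mathlib

open scoped ENNReal NNReal

/-- `z` lies in the resolvent set of the unbounded operator `A`: the operator
`A - z : Dom A → H` has a bounded everywhere defined two-sided inverse. -/
def IsResolventPoint {H : Type*} [NormedAddCommGroup H] [InnerProductSpace ℂ H]
    (A : H →ₗ.[ℂ] H) (z : ℂ) : Prop :=
  ∃ R : H →L[ℂ] H,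
    (∀ u : A.domain, R (A u - z • (u : H)) = u) ∧
    ∀ v : H, ∃ h : R v ∈ A.domain, A ⟨R v, h⟩ - z • R v = v

/-- The spectrum of an unbounded operator. -/
def unboundedSpectrum {H : Type*} [NormedAddCommGroup H] [InnerProductSpace ℂ H]
    (A : H →ₗ.[ℂ] H) : Set ℂ :=
  {z | ¬ IsResolventPoint A z}

/-- `P` is the projection-valued spectral measure of the self-adjoint operator `A`, that is
`A = ∫ x dP(x)`, and `μ u` is the scalar measure `s ↦ ⟨P(s) u, u⟩ = ‖P(s) u‖²`.
Countable additivity of `P` in the strong topology is expressed by `μ u` being a measure. -/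
structure IsSpectralResolution {H : Type*} [NormedAddCommGroup H] [InnerProductSpace ℂ H]
    [CompleteSpace H] (A : H →ₗ.[ℂ] H) (P : Set ℝ → H →L[ℂ] H)
    (μ : H → MeasureTheory.Measure ℝ) : Prop where
  isStarProjection : ∀ s, MeasurableSet s → IsStarProjection (P s)
  univ : P Set.univ = 1
  inter : ∀ s t, MeasurableSet s → MeasurableSet t → P (s ∩ t) = P s * P t
  measure : ∀ u s, MeasurableSet s → μ u s = ENNReal.ofReal (‖P s u‖ ^ 2)
  mem_domain : ∀ u : H, u ∈ A.domain ↔ ∫⁻ x, ENNReal.ofReal (x ^ 2) ∂(μ u) < ∞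
  form : ∀ u : A.domain, inner ℂ (A u) (u : H) = ((∫ x, x ∂(μ (u : H)) : ℝ) : ℂ)

/-- `T = f(A)` in the sense of the functional calculus of the self-adjoint operator `A`, for a
function `f` that is bounded on the spectrum of `A`: `⟨f(A) u, u⟩ = ∫ f(x) d⟨P(x) u, u⟩` for all
`u`, where `P` is the spectral measure of `A`. -/
def IsFunctionOf {H : Type*} [NormedAddCommGroup H] [InnerProductSpace ℂ H]
    [CompleteSpace H] (A : H →ₗ.[ℂ] H) (f : ℝ → ℝ) (T : H →L[ℂ] H) : Prop :=
  ∃ (P : Set ℝ → H →L[ℂ] H) (μ : H → MeasureTheory.Measure ℝ), IsSpectralResolution A P μ ∧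
    ∀ u : H, MeasureTheory.Integrable f (μ u) ∧
      inner ℂ (T u) u = ((∫ x, f x ∂(μ u) : ℝ) : ℂ)

/-- `S = e^{-tA}`. -/
def IsHeatOperator {H : Type*} [NormedAddCommGroup H] [InnerProductSpace ℂ H]
    [CompleteSpace H] (A : H →ₗ.[ℂ] H) (t : ℝ) (S : H →L[ℂ] H) : Prop :=
  IsFunctionOf A (fun x => Real.exp (-(t * x))) S

/-- `E` is the spectral projection of `A` corresponding to the semi-axis `(-∞, l]`. -/
def IsSpectralProjection {H : Type*} [NormedAddCommGroup H] [InnerProductSpace ℂ H]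
    [CompleteSpace H] (A : H →ₗ.[ℂ] H) (l : ℝ) (E : H →L[ℂ] H) : Prop :=
  ∃ (P : Set ℝ → H →L[ℂ] H) (μ : H → MeasureTheory.Measure ℝ), IsSpectralResolution A P μ ∧
    E = P (Set.Iic l)

/-- The operator `V T V⁻¹` for a unitary operator `V`. -/
def unitaryTransport {H K : Type*} [NormedAddCommGroup H] [InnerProductSpace ℂ H]
    [NormedAddCommGroup K] [InnerProductSpace ℂ K] (V : H ≃ₗᵢ[ℂ] K) (T : H →L[ℂ] H) :
    K →L[ℂ] K :=
  (V : H →L[ℂ] K) ∘L T ∘L (V.symm : K →L[ℂ] H)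

/-- Two projections `p`, `q` of a `*`-algebra `𝔄` are Murray-von Neumann equivalent in `𝔄`. -/
def MurrayVonNeumannEquiv {𝔄 : Type*} [Mul 𝔄] [Star 𝔄] (p q : 𝔄) : Prop :=
  IsStarProjection p ∧ IsStarProjection q ∧ ∃ v : 𝔄, p = star v * v ∧ q = v * star v

/-- The commutant of a set of the form `π(𝔄)` is closed under adjoints. -/
theorem centralizer_range_union_star {𝔄 H : Type*} [NonUnitalCStarAlgebra 𝔄]
    [NormedAddCommGroup H] [InnerProductSpace ℂ H] [CompleteSpace H]
    (π : 𝔄 →⋆ₙₐ[ℂ] (H →L[ℂ] H)) :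
    Set.centralizer (Set.range π) ∪ star (Set.centralizer (Set.range π)) =
      Set.centralizer (Set.range π) := by
  apply Set.union_eq_left.mpr
  intro x hx
  rw [Set.mem_star] at hx
  have := Set.star_mem_centralizer' (s := Set.range π) (a := star x) ?_ hx
  · simpa using this
  · rintro _ ⟨a, rfl⟩
    exact ⟨star a, map_star π a⟩

/-- The von Neumann algebra `π(𝔄)''`. -/
noncomputable def bicommutant {𝔄 H : Type*} [NonUnitalCStarAlgebra 𝔄]
    [NormedAddCommGroup H] [InnerProductSpace ℂ H] [CompleteSpace H]
    (π : 𝔄 →⋆ₙₐ[ℂ] (H →L[ℂ] H)) : VonNeumannAlgebra H where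
  toStarSubalgebra := StarSubalgebra.centralizer ℂ (Set.centralizer (Set.range π))
  centralizer_centralizer' := by
    change Set.centralizer (Set.centralizer (Set.centralizer
        (Set.centralizer (Set.range π) ∪ star (Set.centralizer (Set.range π))))) =
      Set.centralizer (Set.centralizer (Set.range π) ∪ star (Set.centralizer (Set.range π)))
    rw [Set.centralizer_centralizer_centralizer]

/-- The underlying set of `π(𝔄)''` is the double commutant of `π(𝔄)`. -/
theorem coe_bicommutant {𝔄 H : Type*} [NonUnitalCStarAlgebra 𝔄]
    [NormedAddCommGroup H] [InnerProductSpace ℂ H] [CompleteSpace H]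
    (π : 𝔄 →⋆ₙₐ[ℂ] (H →L[ℂ] H)) :
    (bicommutant π : Set (H →L[ℂ] H)) = Set.centralizer (Set.centralizer (Set.range π)) := by
  change Set.centralizer
      (Set.centralizer (Set.range π) ∪ star (Set.centralizer (Set.range π))) = _
  rw [centralizer_range_union_star]

/-- `τ` is a faithful, normal, semi-finite trace on the von Neumann algebra `M`. Only the values
of `τ` on the positive cone of `M` matter. -/
structure IsFaithfulNormalSemifiniteTrace {H : Type*} [NormedAddCommGroup H]
    [InnerProductSpace ℂ H] [CompleteSpace H] (M : VonNeumannAlgebra H)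
    (τ : (H →L[ℂ] H) → ℝ≥0∞) : Prop where
  add : ∀ x ∈ M, ∀ y ∈ M, 0 ≤ x → 0 ≤ y → τ (x + y) = τ x + τ y
  smul : ∀ r : ℝ≥0, ∀ x ∈ M, 0 ≤ x → τ (((r : ℝ) : ℂ) • x) = r * τ x
  tracial : ∀ x ∈ M, τ (star x * x) = τ (x * star x)
  faithful : ∀ x ∈ M, 0 ≤ x → τ x = 0 → x = 0
  normal : ∀ D : Set (H →L[ℂ] H), D.Nonempty → DirectedOn (· ≤ ·) D →
    (∀ y ∈ D, y ∈ M ∧ 0 ≤ y) → ∀ x ∈ M, IsLUB D x → τ x = ⨆ y ∈ D, τ y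
  semifinite : ∀ x ∈ M, 0 ≤ x → x ≠ 0 → ∃ y ∈ M, 0 ≤ y ∧ y ≤ x ∧ y ≠ 0 ∧ τ y < ∞

/-- The double commutator `[J, [J, A]] = J [J, A] - [J, A] J` on the domain of `A`, for a bounded
operator `J` that maps this domain to itself. -/
def doubleCommutator {H : Type*} [NormedAddCommGroup H] [InnerProductSpace ℂ H]
    (A : H →ₗ.[ℂ] H) (J : H →L[ℂ] H) (hJ : ∀ u ∈ A.domain, J u ∈ A.domain)
    (u : A.domain) : H :=
  J (J (A u) - A ⟨J u, hJ u u.2⟩) -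
    (J (A ⟨J u, hJ u u.2⟩) - A ⟨J (J u), hJ (J u) (hJ u u.2)⟩)

/-- The assumptions on one operator `A`, bounded from below by `l₀`, and one cut-off operator
`J` with complementary cut-off `J' = (1 - J²)^{1/2}`: both preserve the domain of `A`, the double
commutators with `A` extend to bounded operators of norm at most `γ`, and `A ≥ α` in the sense of
quadratic forms away from the region where `J = 1`. -/
structure IsCutoffLocalized {H : Type*} [NormedAddCommGroup H] [InnerProductSpace ℂ H]
    [CompleteSpace H] (A : H →ₗ.[ℂ] H) (J J' : H →L[ℂ] H) (l₀ γ α : ℝ) : Prop where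
  selfAdjoint : IsSelfAdjoint A
  semibounded : ∀ u : A.domain, l₀ * ‖(u : H)‖ ^ 2 ≤ (inner ℂ (A u) (u : H)).re
  cutoff_selfAdjoint : IsSelfAdjoint J
  cutoff_nonneg : 0 ≤ J
  cutoff_le_one : J ≤ 1
  cutoff_domain : ∀ u ∈ A.domain, J u ∈ A.domain
  compl_selfAdjoint : IsSelfAdjoint J'
  compl_nonneg : 0 ≤ J'
  partition : J * J + J' * J' = 1
  compl_domain : ∀ u ∈ A.domain, J' u ∈ A.domain
  commutator_bound : ∃ C : H →L[ℂ] H, ‖C‖ ≤ γ ∧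
    ∀ u : A.domain, C u = doubleCommutator A J cutoff_domain u
  compl_commutator_bound : ∃ C : H →L[ℂ] H, ‖C‖ ≤ γ ∧
    ∀ u : A.domain, C u = doubleCommutator A J' compl_domain u
  lower_bound : ∀ u : A.domain,
    α * ‖J' u‖ ^ 2 ≤ (inner ℂ (A ⟨J' u, compl_domain u u.2⟩) (J' u)).re

/-! ### Spectral gaps and polar decomposition of bounded operators. -/

section BoundedOperators

variable {H : Type*} [NormedAddCommGroup H] [InnerProductSpace ℂ H] [CompleteSpace H]

/-! Write `X = i₂ J p₁`, so that `X* = Y = i₁ J p₂`. Since `p_l i_l = 1`, one has `X*X = J₁²` and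
`Y*Y = J₂²`, hence `‖Xu‖ = ‖J₁u‖` and `‖Yv‖ = ‖J₂v‖`. Low-energy vectors live where the cut-off is
felt: by the IMS formula (`IsCutoffLocalized.localization`) and the bound `A ≥ α` on the range of
`J'`, a vector of energy at most `l` with `l + γ < α` cannot be killed by the cut-off `J_l`, and its
cut-off has energy at most `l + γ`. The form comparison then bounds the energy of its image under
`X` or `Y`, so a definite part of the image lies in the low-energy subspace of the other operator
(`IsCutoffLocalized.le_norm_sq_apply`).

Consequently `T = E₂(λ₂) X E₁(λ₁)`, transported to `H`, is bounded below on the range of `E₁(λ₁)`,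
and its adjoint is injective on the range of `E₂(λ₂)`. As `T*T` has a gap above `0`, the partial
isometry of the polar decomposition is `T g(T*T)` with `g` continuous and `g(0) = 0`
(`exists_partial_isometry`). This requires no knowledge of the spectrum of `A₂`, and it gives
equivalence in `π(𝔄)''`. The trace of `E₂(λ₂)` is therefore the same for all `λ₂` in `(a₂, b₂)`; it
is finite because `e^{-λ} E(λ) ≤ e^{-A}`, and faithfulness makes `E₂` constant there. This is the
gap of `A₂`.

With gaps on both sides the spectral projections are continuous functions, vanishing at `0`, of the
heat operators. So they lie in `π(𝔄)`; then so does `T`, by the multiplier hypothesis on `X`, and so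
does `T g(T*T)`. -/

omit [CompleteSpace H] in
theorem re_inner_le_of_le {S T : H →L[ℂ] H} (h : S ≤ T) (u : H) :
    (inner ℂ (S u) u).re ≤ (inner ℂ (T u) u).re := by
  have := ((ContinuousLinearMap.le_def S T).1 h).re_inner_nonneg_left u
  simpa [inner_sub_left] using this

theorem IsSelfAdjoint.inner_map_left {B : H →L[ℂ] H} (hB : IsSelfAdjoint B) (u v : H) :
    inner ℂ (B u) v = inner ℂ u (B v) := by
  conv_lhs => rw [← hB.adjoint_eq]
  exact ContinuousLinearMap.adjoint_inner_left B v u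

omit [CompleteSpace H] in
theorem inner_self_re_eq_norm_sq (u : H) : (inner ℂ u u).re = ‖u‖ ^ 2 := by
  rw [← inner_self_eq_norm_sq (𝕜 := ℂ) u]; rfl

/-- A function that vanishes above `c'` kills every reducing subspace on which `S ≥ c > c'`. -/
theorem cfc_mul_eq_zero_of_lower_bound {S P : H →L[ℂ] H} (hS : IsSelfAdjoint S)
    (hPS : Commute P S) {c c' : ℝ} (hc : c' < c)
    (hP : ∀ u, c * ‖P u‖ ^ 2 ≤ (inner ℂ (S (P u)) (P u)).re)
    {h : ℝ → ℝ} (hh : Continuous h) (h0 : ∀ x, c' ≤ x → h x = 0) : cfc h S * P = 0 := by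
  have hB : IsSelfAdjoint (cfc h S) := IsSelfAdjoint.cfc
  have hcomm : Commute (cfc h S) P := hPS.symm.cfc_real h
  -- Pointwise `x h(x)² ≤ c' h(x)²`. With `w = h(S)Pu = P h(S)u` this gives `c‖w‖² ≤ ⟨Sw, w⟩ ≤
  -- c'‖w‖²`, so `w = 0`.
  have hle : cfc h S * S * cfc h S ≤ (c' : ℝ) • (cfc h S * cfc h S) := by
    have e1 : cfc h S * S * cfc h S = cfc (fun x => h x * x * h x) S := by
      rw [cfc_mul (fun x => h x * x) h S, cfc_mul h (fun x => x) S, cfc_id' ℝ S]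
    have e2 : (c' : ℝ) • (cfc h S * cfc h S) = cfc (fun x => c' * (h x * h x)) S := by
      rw [cfc_const_mul c' (fun x => h x * h x) S, cfc_mul h h S]
    rw [e1, e2]
    refine cfc_mono fun x _ => ?_
    rcases le_total c' x with hx | hx
    · simp [h0 x hx]
    · nlinarith [mul_self_nonneg (h x)]
  ext u
  have hcu : P (cfc h S u) = cfc h S (P u) := by
    have := congrArg (fun T : H →L[ℂ] H => T u) hcomm.eq
    simpa using this.symm
  have h1 := hP (cfc h S u)
  rw [hcu] at h1
  have h2 := re_inner_le_of_le hle (P u)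
  have h3 : (inner ℂ ((cfc h S * S * cfc h S) (P u)) (P u)).re =
      (inner ℂ (S (cfc h S (P u))) (cfc h S (P u))).re := by
    simp only [mul_apply_eq_comp]
    rw [hB.inner_map_left]
  have h4 : (inner ℂ (((c' : ℝ) • (cfc h S * cfc h S)) (P u)) (P u)).re =
      c' * ‖cfc h S (P u)‖ ^ 2 := by
    simp only [mul_apply_eq_comp, smul_apply]
    rw [← inner_self_re_eq_norm_sq, inner_smul_left_eq_smul,
      hB.inner_map_left]
    simp
  have h5 : ‖cfc h S (P u)‖ ^ 2 = 0 := by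
    have := sq_nonneg ‖cfc h S (P u)‖
    nlinarith
  simpa using h5

/-- A function that vanishes below `d'` kills every reducing subspace on which `S ≤ d < d'`. -/
theorem cfc_mul_eq_zero_of_upper_bound {S P : H →L[ℂ] H} (hS : IsSelfAdjoint S)
    (hPS : Commute P S) {d d' : ℝ} (hd : d < d')
    (hP : ∀ u, (inner ℂ (S (P u)) (P u)).re ≤ d * ‖P u‖ ^ 2)
    {h : ℝ → ℝ} (hh : Continuous h) (h0 : ∀ x, x ≤ d' → h x = 0) : cfc h S * P = 0 := by
  have h1 := cfc_mul_eq_zero_of_lower_bound (S := -S) (P := P) hS.neg hPS.neg_right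
    (c := -d) (c' := -d') (by linarith)
    (fun u => by
      have := hP u
      simp only [neg_apply, inner_neg_left, Complex.neg_re]
      linarith)
    (h := fun x => h (-x)) (by fun_prop) (fun x hx => h0 _ (by linarith))
  have h2 : cfc (fun x => h (-x)) (-S) = cfc h S := by
    have := cfc_comp_neg (fun x => h (-x)) S
    simpa using this.symm
  rwa [h2] at h1

/-- A projection splitting the spectrum of `S` is a continuous function of `S`. -/
theorem cfc_eq_of_spectral_gap {S P : H →L[ℂ] H} (hS : IsSelfAdjoint S)
    (hPS : Commute P S) {c c' d d' : ℝ} (hc : c' < c) (hd : d < d')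
    (hP : ∀ u, c * ‖P u‖ ^ 2 ≤ (inner ℂ (S (P u)) (P u)).re)
    (hP' : ∀ u, (inner ℂ (S ((1 - P) u)) ((1 - P) u)).re ≤ d * ‖(1 - P) u‖ ^ 2)
    {f : ℝ → ℝ} (hf : Continuous f) (h1 : ∀ x, c' ≤ x → f x = 1) (h0 : ∀ x, x ≤ d' → f x = 0) :
    cfc f S = P := by
  have e1 := cfc_mul_eq_zero_of_lower_bound hS hPS hc hP (h := fun x => 1 - f x) (by fun_prop)
    (fun x hx => by simp [h1 x hx])
  have e2 := cfc_mul_eq_zero_of_upper_bound hS (P := 1 - P)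
    ((Commute.one_left S).sub_left hPS) hd hP' hf h0
  rw [cfc_sub (fun _ => (1 : ℝ)) f S, cfc_const_one ℝ S, sub_mul, one_mul, sub_eq_zero] at e1
  rw [mul_sub, mul_one, sub_eq_zero, ← e1] at e2
  exact e2

/-- The piecewise linear function that is `0` below `d` and `1` above `c`. -/
noncomputable def ramp (d c x : ℝ) : ℝ := max 0 (min 1 ((x - d) / (c - d)))

@[fun_prop]
theorem continuous_ramp (d c : ℝ) : Continuous (ramp d c) := by
  unfold ramp; fun_prop

theorem ramp_of_le {d c x : ℝ} (h : d < c) (hx : x ≤ d) : ramp d c x = 0 := by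
  have : (x - d) / (c - d) ≤ 0 := div_nonpos_of_nonpos_of_nonneg (by linarith) (by linarith)
  rw [ramp, max_eq_left]
  exact (min_le_right _ _).trans this

theorem ramp_of_ge {d c x : ℝ} (h : d < c) (hx : c ≤ x) : ramp d c x = 1 := by
  have : 1 ≤ (x - d) / (c - d) := by
    rw [le_div_iff₀ (by linarith)]; linarith
  rw [ramp, min_eq_left this]; simp

theorem ramp_nonneg (d c x : ℝ) : 0 ≤ ramp d c x := le_max_left _ _

/-- An operator that is bounded below between the ranges of two projections, with injective
adjoint, has a polar decomposition whose partial isometry is obtained by continuous functional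
calculus. -/
theorem exists_partial_isometry {T E F : H →L[ℂ] H} (hE : IsStarProjection E)
    (hF : IsStarProjection F) (hTE : T * E = T) (hFT : F * T = T) {c : ℝ} (hc : 0 < c)
    (hbelow : ∀ u, c * ‖E u‖ ^ 2 ≤ ‖T (E u)‖ ^ 2)
    (hinj : ∀ u, F u = u → star T u = 0 → u = 0) :
    ∃ g : ℝ → ℝ, Continuous g ∧ g 0 = 0 ∧
      star (T * cfcₙ g (star T * T)) * (T * cfcₙ g (star T * T)) = E ∧
      (T * cfcₙ g (star T * T)) * star (T * cfcₙ g (star T * T)) = F := by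
  have hEsa : star E = E := hE.isSelfAdjoint
  have hFsa : star F = F := hF.isSelfAdjoint
  have hET : E * star T = star T := by
    conv_lhs => rw [← hEsa, ← star_mul, hTE]
  have hTF : star T * F = star T := by
    conv_lhs => rw [← hFsa, ← star_mul, hFT]
  set B := star T * T with hBdef
  have hB : IsSelfAdjoint B := IsSelfAdjoint.star_mul_self T
  have hEB : E * B = B := by rw [hBdef, ← mul_assoc, hET]
  have hBE : B * E = B := by rw [hBdef, mul_assoc, hTE]
  set f := ramp (c / 4) (c / 2) with hfdef
  have hf0 : ∀ x, x ≤ c / 4 → f x = 0 := fun x hx => ramp_of_le (by linarith) hx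
  have hf1 : ∀ x, c / 2 ≤ x → f x = 1 := fun x hx => ramp_of_ge (by linarith) hx
  have hfc : Continuous f := continuous_ramp _ _
  have hfnn : ∀ x, 0 ≤ f x := fun x => ramp_nonneg _ _ x
  have hfB : cfc f B = E := by
    refine cfc_eq_of_spectral_gap hB (show E * B = B * E by rw [hEB, hBE])
      (c := c) (c' := c / 2) (d := 0) (d' := c / 4) (by linarith) (by linarith) ?_ ?_
      hfc hf1 hf0
    · intro u
      have : inner ℂ (B (E u)) (E u) = inner ℂ (T (E u)) (T (E u)) := by
        rw [hBdef, mul_apply_eq_comp]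
        exact ContinuousLinearMap.adjoint_inner_left T _ _
      rw [this, inner_self_re_eq_norm_sq]
      exact hbelow u
    · intro u
      have : B ((1 - E) u) = 0 := by
        rw [← mul_apply_eq_comp, mul_sub, mul_one, hBE]; simp
      rw [this]; simp
  clear_value f
  -- Here `g` is `(f/x)^{1/2}`; replacing `x` by `max x (c/4)` keeps it continuous and changes
  -- nothing where `f ≠ 0`.
  obtain ⟨g, hg, hg0, hgx⟩ : ∃ g : ℝ → ℝ, Continuous g ∧ g 0 = 0 ∧ ∀ x, x * g x * g x = f x := by
    have hmax : ∀ x, 0 < max x (c / 4) := fun x => lt_max_of_lt_right (by linarith)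
    refine ⟨fun x => Real.sqrt (f x / max x (c / 4)),
      Real.continuous_sqrt.comp (hfc.div (by fun_prop) fun x => (hmax x).ne'),
      by simp [hf0 0 (by linarith)], fun x => ?_⟩
    rw [mul_assoc, Real.mul_self_sqrt (div_nonneg (hfnn x) (hmax x).le)]
    rcases le_total x (c / 4) with hx | hx
    · simp [hf0 x hx]
    · rw [max_eq_left hx]
      have : x ≠ 0 := by linarith
      field_simp
  have hGsa : star (cfc g B) = cfc g B := (IsSelfAdjoint.cfc (f := g) (a := B)).star_eq
  have hBGG : B * cfc g B * cfc g B = E := by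
    rw [← hfB, ← funext hgx, cfc_mul (fun x => x * g x) g B
      (continuous_id.mul hg).continuousOn hg.continuousOn,
      cfc_mul (fun x => x) g B continuous_id.continuousOn hg.continuousOn, cfc_id' ℝ B]
  have hGB : cfc g B * B = B * cfc g B :=
    ((Commute.refl B).cfc_real g).eq
  have hV : star (T * cfc g B) * (T * cfc g B) = E := by
    rw [star_mul, hGsa]
    calc cfc g B * star T * (T * cfc g B) = cfc g B * B * cfc g B := by
          rw [hBdef]; simp only [mul_assoc]
      _ = E := by rw [hGB, hBGG]
  refine ⟨g, hg, hg0, ?_⟩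
  rw [cfcₙ_eq_cfc (f := g) (a := B) hg.continuousOn hg0]
  refine ⟨hV, ?_⟩
  set V := T * cfc g B with hVdef
  have hEE : E * E = E := hE.isIdempotentElem
  have hVE : V * E = V := by
    have h0 : star (V * (1 - E)) * (V * (1 - E)) = 0 := by
      rw [star_mul, show star (1 - E) * star V * (V * (1 - E)) =
        star (1 - E) * ((star V * V) * (1 - E)) by simp only [mul_assoc], hV, mul_sub, mul_one,
        hEE, sub_self, mul_zero]
    have := CStarRing.star_mul_self_eq_zero_iff _ |>.1 h0
    rw [mul_sub, mul_one, sub_eq_zero] at this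
    exact this.symm
  have hVV : V * star V * V = V := by rw [mul_assoc, hV, hVE]
  have hFV : F * V = V := by rw [hVdef, ← mul_assoc, hFT]
  -- If `V*u = g(B)T*u = 0`, then `T*u = E T*u = B g(B)² T*u = 0`. Applied below to vectors in the
  -- range of `F - VV*`, on which `V*` vanishes.
  have hkey : ∀ u, F u = u → star V u = 0 → u = 0 := by
    intro u hu hVu
    refine hinj u hu ?_
    have h1 : cfc g B (star T u) = 0 := by
      rw [hVdef, star_mul, hGsa] at hVu; exact hVu
    have h2 : E (star T u) = star T u := by
      rw [← mul_apply_eq_comp, hET]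
    rw [← h2, ← hBGG]
    simp [mul_apply_eq_comp, h1]
  have hFF : F * F = F := hF.isIdempotentElem
  ext w
  have h1 := hkey ((F - V * star V) w) (by
      rw [← mul_apply_eq_comp, mul_sub, hFF, ← mul_assoc, hFV]) (by
      rw [← mul_apply_eq_comp, mul_sub]
      have a1 : star V * F = star V := by
        conv_lhs => rw [← hFsa, ← star_mul, hFV]
      have a2 : star V * (V * star V) = star V := by
        have := congrArg star hVV
        simpa [mul_assoc] using this
      rw [a1, a2]; simp)
  simp only [sub_apply, sub_eq_zero] at h1
  exact h1.symm

end BoundedOperators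

/-! ### Calculus of the spectral measure. -/

section SpectralResolution

open MeasureTheory

variable {H : Type*} [NormedAddCommGroup H] [InnerProductSpace ℂ H] [CompleteSpace H]

namespace IsSpectralResolution

variable {A : H →ₗ.[ℂ] H} {P : Set ℝ → H →L[ℂ] H} {μ : H → Measure ℝ}

theorem apply_apply (hP : IsSpectralResolution A P μ) {s t : Set ℝ} (hs : MeasurableSet s)
    (ht : MeasurableSet t) (u : H) : P s (P t u) = P (s ∩ t) u := by
  rw [hP.inter s t hs ht, mul_apply_eq_comp]

theorem apply_self (hP : IsSpectralResolution A P μ) {s : Set ℝ} (hs : MeasurableSet s) (u : H) :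
    P s (P s u) = P s u := by
  rw [hP.apply_apply hs hs, Set.inter_self]

theorem measure_apply (hP : IsSpectralResolution A P μ) {s : Set ℝ} (hs : MeasurableSet s)
    (u : H) : μ (P s u) = (μ u).restrict s := by
  ext t ht
  rw [Measure.restrict_apply ht, hP.measure _ t ht, hP.measure _ _ (ht.inter hs),
    hP.apply_apply ht hs]

theorem eq_zero_iff (hP : IsSpectralResolution A P μ) {s : Set ℝ} (hs : MeasurableSet s) (u : H) :
    P s u = 0 ↔ μ u s = 0 := by
  rw [hP.measure u s hs]
  simp

theorem measure_univ (hP : IsSpectralResolution A P μ) (u : H) :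
    μ u Set.univ = ENNReal.ofReal (‖u‖ ^ 2) := by
  rw [hP.measure u _ MeasurableSet.univ, hP.univ]; simp

theorem isFiniteMeasure (hP : IsSpectralResolution A P μ) (u : H) : IsFiniteMeasure (μ u) :=
  ⟨by rw [hP.measure_univ]; exact ENNReal.ofReal_lt_top⟩

theorem measureReal_univ (hP : IsSpectralResolution A P μ) (u : H) :
    (μ u).real Set.univ = ‖u‖ ^ 2 := by
  rw [measureReal_def, hP.measure_univ, ENNReal.toReal_ofReal (by positivity)]

theorem isSelfAdjoint (hP : IsSpectralResolution A P μ) {s : Set ℝ} (hs : MeasurableSet s) :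
    IsSelfAdjoint (P s) := (hP.isStarProjection s hs).isSelfAdjoint

theorem empty (hP : IsSpectralResolution A P μ) : P ∅ = 0 := by
  ext u
  simpa using (hP.eq_zero_iff MeasurableSet.empty u).2 (by simp)

theorem apply_of_disjoint (hP : IsSpectralResolution A P μ) {s t : Set ℝ} (hs : MeasurableSet s)
    (ht : MeasurableSet t) (h : Disjoint s t) (u : H) : P s (P t u) = 0 := by
  rw [hP.apply_apply hs ht, h.inter_eq, hP.empty]; simp

theorem norm_sq_apply (hP : IsSpectralResolution A P μ) {s : Set ℝ} (hs : MeasurableSet s)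
    (u : H) : ‖P s u‖ ^ 2 = (μ u).real s := by
  rw [measureReal_def, hP.measure u s hs, ENNReal.toReal_ofReal (by positivity)]

theorem inner_apply_apply (hP : IsSpectralResolution A P μ) {s t : Set ℝ} (hs : MeasurableSet s)
    (ht : MeasurableSet t) (h : Disjoint s t) (u v : H) : inner ℂ (P s u) (P t v) = 0 := by
  rw [(hP.isSelfAdjoint hs).inner_map_left, hP.apply_of_disjoint hs ht h, inner_zero_right]

/-- Additivity of `P` is recovered from that of the scalar measures: the remainder `w` is
annihilated by `P s` and `P t`, so `μ w` is null on `s ∪ t`. -/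
theorem add_of_disjoint (hP : IsSpectralResolution A P μ) {s t : Set ℝ} (hs : MeasurableSet s)
    (ht : MeasurableSet t) (h : Disjoint s t) (u : H) : P (s ∪ t) u = P s u + P t u := by
  have e1 : P (s ∪ t) (P s u) = P s u := by
    rw [hP.apply_apply (hs.union ht) hs, Set.inter_eq_right.2 Set.subset_union_left]
  have e2 : P (s ∪ t) (P t u) = P t u := by
    rw [hP.apply_apply (hs.union ht) ht, Set.inter_eq_right.2 Set.subset_union_right]
  set w := u - (P s u + P t u) with hw
  have hws : P s w = 0 := by
    rw [hw, map_sub, map_add, hP.apply_self hs, hP.apply_of_disjoint hs ht h]; simp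
  have hwt : P t w = 0 := by
    rw [hw, map_sub, map_add, hP.apply_self ht, hP.apply_of_disjoint ht hs h.symm]; simp
  have : P (s ∪ t) w = 0 := by
    rw [hP.eq_zero_iff (hs.union ht), measure_union_null_iff]
    exact ⟨(hP.eq_zero_iff hs w).1 hws, (hP.eq_zero_iff ht w).1 hwt⟩
  rw [hw, map_sub, map_add, e1, e2, sub_eq_zero] at this
  exact this

theorem compl_apply (hP : IsSpectralResolution A P μ) {s : Set ℝ} (hs : MeasurableSet s) (u : H) :
    P s u + P sᶜ u = u := by
  rw [← hP.add_of_disjoint hs hs.compl disjoint_compl_right, Set.union_compl_self, hP.univ]; simp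

theorem norm_sq_add_compl (hP : IsSpectralResolution A P μ) {s : Set ℝ} (hs : MeasurableSet s)
    (u : H) : ‖P s u‖ ^ 2 + ‖P sᶜ u‖ ^ 2 = ‖u‖ ^ 2 := by
  have := hP.isFiniteMeasure u
  rw [hP.norm_sq_apply hs, hP.norm_sq_apply hs.compl, ← hP.measureReal_univ,
    measureReal_add_measureReal_compl hs]

theorem apply_mem_domain (hP : IsSpectralResolution A P μ) {s : Set ℝ} (hs : MeasurableSet s)
    {u : H} (hu : u ∈ A.domain) : P s u ∈ A.domain := by
  rw [hP.mem_domain, hP.measure_apply hs]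
  exact (lintegral_mono' Measure.restrict_le_self le_rfl).trans_lt ((hP.mem_domain u).1 hu)

theorem integrable_id (hP : IsSpectralResolution A P μ) {u : H} (hu : u ∈ A.domain) :
    Integrable (fun x : ℝ => x) (μ u) := by
  have := hP.isFiniteMeasure u
  have h2 : Integrable (fun x : ℝ => x ^ 2) (μ u) := by
    refine ⟨by fun_prop, ?_⟩
    rw [hasFiniteIntegral_iff_ofReal (Filter.Eventually.of_forall fun x => sq_nonneg x)]
    exact (hP.mem_domain u).1 hu
  refine (h2.add (integrable_const (1 : ℝ))).mono' (by fun_prop)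
    (Filter.Eventually.of_forall fun x => ?_)
  simp only [Real.norm_eq_abs, Pi.add_apply]
  rw [abs_le]
  constructor <;> nlinarith [sq_nonneg (x - 1), sq_nonneg (x + 1)]

/-- An operator whose quadratic form is given by integration against the scalar spectral measures
commutes with the spectral projections. -/
theorem map_apply_of_form (hP : IsSpectralResolution A P μ) {B : H →ₗ.[ℂ] H}
    (hd : Dense (B.domain : Set H)) {f : ℝ → ℝ}
    (hdom : ∀ s, MeasurableSet s → ∀ u ∈ B.domain, P s u ∈ B.domain)
    (hf : ∀ u : B.domain, Integrable f (μ u) ∧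
      inner ℂ (B u) (u : H) = ((∫ x, f x ∂(μ (u : H)) : ℝ) : ℂ))
    {s : Set ℝ} (hs : MeasurableSet s) (u : B.domain) :
    B ⟨P s u, hdom s hs u u.2⟩ = P s (B u) := by
  -- The quadratic form is additive along `P t` and `P tᶜ`, so the mixed terms cancel; replacing `a`
  -- by `i a` then separates the two mixed terms and makes each vanish.
  have cross : ∀ (t : Set ℝ), MeasurableSet t → ∀ a b : B.domain, P t a = a → P tᶜ b = b →
      inner ℂ (B a) (b : H) + inner ℂ (B b) (a : H) = 0 := by
    intro t ht a b ha hb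
    have h1 := (hf (a + b)).2
    have ea : P t (a + b : B.domain) = a := by
      have : P t (b : H) = 0 := by
        rw [← hb, hP.apply_of_disjoint ht ht.compl disjoint_compl_right]
      simp [ha, this]
    have eb : P tᶜ (a + b : B.domain) = b := by
      have : P tᶜ (a : H) = 0 := by
        rw [← ha, hP.apply_of_disjoint ht.compl ht disjoint_compl_left]
      simp [hb, this]
    rw [← integral_add_compl ht (hf (a + b)).1, ← hP.measure_apply ht,
      ← hP.measure_apply ht.compl, ea, eb, Complex.ofReal_add, ← (hf a).2, ← (hf b).2] at h1
    simp only [LinearPMap.map_add, Submodule.coe_add, inner_add_left, inner_add_right] at h1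
    linear_combination h1
  have orth : ∀ (t : Set ℝ), MeasurableSet t → ∀ a b : B.domain, P t a = a → P tᶜ b = b →
      inner ℂ (B a) (b : H) = 0 := by
    intro t ht a b ha hb
    have h1 := cross t ht a b ha hb
    have h2 := cross t ht (Complex.I • a) b (by simp [ha]) hb
    simp only [Submodule.coe_smul, inner_smul_left, inner_smul_right,
      LinearPMap.map_smul, Complex.conj_I] at h2
    have h3 : Complex.I * (inner ℂ (B b) (a : H) - inner ℂ (B a) (b : H)) = 0 := by
      linear_combination h2
    have h4 := (mul_eq_zero.1 h3).resolve_left Complex.I_ne_zero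
    linear_combination (1 / 2 : ℂ) * h1 - (1 / 2 : ℂ) * h4
  have inv : ∀ (t : Set ℝ), MeasurableSet t → ∀ a : B.domain, P t a = a → P tᶜ (B a) = 0 := by
    intro t ht a ha
    refine hd.eq_zero_of_inner_left ℂ fun v hv => ?_
    rw [(hP.isSelfAdjoint ht.compl).inner_map_left]
    exact orth t ht a ⟨P tᶜ v, hdom _ ht.compl v hv⟩ ha (hP.apply_self ht.compl v)
  set a : B.domain := ⟨P s u, hdom s hs u u.2⟩
  set b : B.domain := ⟨P sᶜ u, hdom _ hs.compl u u.2⟩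
  have hab : u = a + b := Subtype.ext (hP.compl_apply hs u).symm
  have ha : P sᶜ (B a) = 0 := inv s hs a (hP.apply_self hs _)
  have hb : P s (B b) = 0 := by
    simpa using inv sᶜ hs.compl b (hP.apply_self hs.compl _)
  have hBa : P s (B a) = B a := by
    conv_rhs => rw [← hP.compl_apply hs (B a), ha, add_zero]
  conv_rhs => rw [hab, B.map_add, map_add, hb, add_zero, hBa]

theorem map_apply (hP : IsSpectralResolution A P μ) (hA : IsSelfAdjoint A) {s : Set ℝ}
    (hs : MeasurableSet s) (u : A.domain) :
    A ⟨P s u, hP.apply_mem_domain hs u.2⟩ = P s (A u) :=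
  hP.map_apply_of_form hA.dense_domain (fun _ ht _ hu => hP.apply_mem_domain ht hu)
    (fun u => ⟨hP.integrable_id u.2, hP.form u⟩) hs u

theorem integral_le (hP : IsSpectralResolution A P μ) {f : ℝ → ℝ} {s : Set ℝ}
    (hs : MeasurableSet s) {u : H} (hu : P s u = u) (hf : Integrable f (μ u)) {l : ℝ}
    (h : ∀ x ∈ s, f x ≤ l) : ∫ x, f x ∂(μ u) ≤ l * ‖u‖ ^ 2 := by
  have := hP.isFiniteMeasure u
  have hr : μ u = (μ u).restrict s := by
    conv_lhs => rw [← hu, hP.measure_apply hs]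
  calc ∫ x, f x ∂(μ u) ≤ ∫ _, l ∂(μ u) := by
        refine integral_mono_ae hf (integrable_const l) ?_
        rw [hr]
        exact (ae_restrict_iff' hs).2 (Filter.Eventually.of_forall h)
    _ = l * ‖u‖ ^ 2 := by rw [integral_const, hP.measureReal_univ, smul_eq_mul, mul_comm]

theorem le_integral (hP : IsSpectralResolution A P μ) {f : ℝ → ℝ} {s : Set ℝ}
    (hs : MeasurableSet s) {u : H} (hu : P s u = u) (hf : Integrable f (μ u)) {l : ℝ}
    (h : ∀ x ∈ s, l ≤ f x) : l * ‖u‖ ^ 2 ≤ ∫ x, f x ∂(μ u) := by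
  have := hP.integral_le hs hu hf.neg (l := -l) (fun x hx => by simpa using h x hx)
  simp only [Pi.neg_apply, integral_neg] at this
  linarith

theorem re_form (hP : IsSpectralResolution A P μ) (u : A.domain) :
    (inner ℂ (A u) (u : H)).re = ∫ x, x ∂(μ (u : H)) := by
  rw [hP.form]; simp

theorem form_le (hP : IsSpectralResolution A P μ) {s : Set ℝ} (hs : MeasurableSet s)
    (u : A.domain) (hu : P s u = u) {l : ℝ} (h : ∀ x ∈ s, x ≤ l) :
    (inner ℂ (A u) (u : H)).re ≤ l * ‖(u : H)‖ ^ 2 := by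
  rw [hP.re_form]; exact hP.integral_le hs hu (hP.integrable_id u.2) h

theorem le_form (hP : IsSpectralResolution A P μ) {s : Set ℝ} (hs : MeasurableSet s)
    (u : A.domain) (hu : P s u = u) {l : ℝ} (h : ∀ x ∈ s, l ≤ x) :
    l * ‖(u : H)‖ ^ 2 ≤ (inner ℂ (A u) (u : H)).re := by
  rw [hP.re_form]; exact hP.le_integral hs hu (hP.integrable_id u.2) h

/-- `⟨A u, u⟩` splits along a spectral projection. -/
theorem re_form_split (hP : IsSpectralResolution A P μ) {s : Set ℝ} (hs : MeasurableSet s)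
    (u : A.domain) : (inner ℂ (A u) (u : H)).re =
      (inner ℂ (A ⟨P s u, hP.apply_mem_domain hs u.2⟩) (P s u)).re +
      (inner ℂ (A ⟨P sᶜ u, hP.apply_mem_domain hs.compl u.2⟩) (P sᶜ u)).re := by
  rw [hP.re_form u, hP.re_form ⟨P s u, _⟩, hP.re_form ⟨P sᶜ u, _⟩]
  simp only
  rw [hP.measure_apply hs, hP.measure_apply hs.compl, integral_add_compl hs (hP.integrable_id u.2)]

theorem mem_domain_of_bounded (hP : IsSpectralResolution A P μ) {s : Set ℝ}
    (hs : MeasurableSet s) {u : H} (hu : P s u = u) {f : ℝ → ℝ} (hf : Integrable f (μ u))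
    (h : ∀ x ∈ s, x ^ 2 ≤ f x) : u ∈ A.domain := by
  have hr : μ u = (μ u).restrict s := by
    conv_lhs => rw [← hu, hP.measure_apply hs]
  rw [hP.mem_domain]
  refine (lintegral_mono_ae (g := fun x => ENNReal.ofReal (f x)) ?_).trans_lt hf.lintegral_lt_top
  rw [hr]
  exact (ae_restrict_iff' hs).2
    (Filter.Eventually.of_forall fun x hx => ENNReal.ofReal_le_ofReal (h x hx))

section Function

variable {f : ℝ → ℝ} {S : H →L[ℂ] H}

theorem isSelfAdjoint_function
    (hS : ∀ u : H, Integrable f (μ u) ∧ inner ℂ (S u) u = ((∫ x, f x ∂(μ u) : ℝ) : ℂ)) :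
    IsSelfAdjoint S := by
  rw [ContinuousLinearMap.isSelfAdjoint_iff_isSymmetric,
    LinearMap.isSymmetric_iff_inner_map_self_real]
  intro u
  rw [ContinuousLinearMap.coe_coe, (hS u).2]
  simp

theorem commute_function (hP : IsSpectralResolution A P μ)
    (hS : ∀ u : H, Integrable f (μ u) ∧ inner ℂ (S u) u = ((∫ x, f x ∂(μ u) : ℝ) : ℂ))
    {s : Set ℝ} (hs : MeasurableSet s) : Commute (P s) S := by
  have := hP.map_apply_of_form (B := (S : H →ₗ[ℂ] H).toPMap ⊤) (f := f)
    (by simp) (fun _ _ _ _ => trivial) (fun u => hS u) hs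
  ext u
  simpa using (this ⟨u, trivial⟩).symm

theorem function_le (hP : IsSpectralResolution A P μ)
    (hS : ∀ u : H, Integrable f (μ u) ∧ inner ℂ (S u) u = ((∫ x, f x ∂(μ u) : ℝ) : ℂ))
    {s : Set ℝ} (hs : MeasurableSet s) {l : ℝ} (h : ∀ x ∈ s, f x ≤ l) (u : H) :
    (inner ℂ (S (P s u)) (P s u)).re ≤ l * ‖P s u‖ ^ 2 := by
  rw [(hS _).2, Complex.ofReal_re]
  exact hP.integral_le hs (hP.apply_self hs u) (hS _).1 h

theorem le_function (hP : IsSpectralResolution A P μ)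
    (hS : ∀ u : H, Integrable f (μ u) ∧ inner ℂ (S u) u = ((∫ x, f x ∂(μ u) : ℝ) : ℂ))
    {s : Set ℝ} (hs : MeasurableSet s) {l : ℝ} (h : ∀ x ∈ s, l ≤ f x) (u : H) :
    l * ‖P s u‖ ^ 2 ≤ (inner ℂ (S (P s u)) (P s u)).re := by
  rw [(hS _).2, Complex.ofReal_re]
  exact hP.le_integral hs (hP.apply_self hs u) (hS _).1 h

end Function

end IsSpectralResolution

end SpectralResolution

/-! ### Spectral projections and the operator `e^{-A}`. -/

section HeatOperator

open MeasureTheory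

variable {H : Type*} [NormedAddCommGroup H] [InnerProductSpace ℂ H] [CompleteSpace H]

/-- `S = e^{-A}`, with respect to a given spectral resolution of `A`. -/
def IsUnitHeat (μ : H → Measure ℝ) (S : H →L[ℂ] H) : Prop :=
  ∀ u : H, Integrable (fun x => Real.exp (-x)) (μ u) ∧
    inner ℂ (S u) u = ((∫ x, Real.exp (-x) ∂(μ u) : ℝ) : ℂ)

namespace IsSpectralResolution

variable {A : H →ₗ.[ℂ] H} {P : Set ℝ → H →L[ℂ] H} {μ : H → Measure ℝ} {S : H →L[ℂ] H}

/-- On `(-∞, l]` one has `x² ≤ 2e^{-x} + l²`, and the right-hand side is integrable because `e^{-A}`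
is everywhere defined. -/
theorem mem_domain_of_apply_Iic (hP : IsSpectralResolution A P μ) (hS : IsUnitHeat μ S) {l : ℝ}
    {u : H} (hu : P (Set.Iic l) u = u) : u ∈ A.domain := by
  have := hP.isFiniteMeasure u
  refine hP.mem_domain_of_bounded measurableSet_Iic hu
    (f := fun x => 2 * Real.exp (-x) + l ^ 2) (((hS u).1.const_mul 2).add (integrable_const _)) ?_
  intro x hx
  have hx : x ≤ l := hx
  rcases le_total 0 x with h | h
  · have := Real.exp_pos (-x)
    nlinarith
  · have := Real.quadratic_le_exp_of_nonneg (x := -x) (by linarith)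
    nlinarith [sq_nonneg l]

/-- A spectral projection at a gap is a continuous function of the heat operator. -/
theorem exists_cfc_eq (hP : IsSpectralResolution A P μ) (hS : IsUnitHeat μ S) {l l' : ℝ}
    (hl : l < l') (hgap : P (Set.Ioo l l') = 0) :
    ∃ f : ℝ → ℝ, Continuous f ∧ f 0 = 0 ∧ cfc f S = P (Set.Iic l) := by
  have he : Real.exp (-l') < Real.exp (-l) := Real.exp_lt_exp.2 (by linarith)
  have he0 := Real.exp_pos (-l')
  obtain ⟨d, hd1, hd2⟩ := exists_between he
  obtain ⟨c, hc1, hc2⟩ := exists_between hd2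
  -- The ramp vanishes at `0` because `d > e^{-l'} > 0`; this is what allows functional calculus
  -- without a unit.
  refine ⟨ramp d c, continuous_ramp _ _, ramp_of_le hc1 (by linarith), ?_⟩
  have hcompl : ∀ u, (1 - P (Set.Iic l)) u = P (Set.Ici l') u := by
    intro u
    have e1 := hP.compl_apply (measurableSet_Iic (a := l)) u
    rw [Set.compl_Iic, ← Set.Ioo_union_Ici_eq_Ioi hl, hP.add_of_disjoint measurableSet_Ioo
      measurableSet_Ici, hgap] at e1
    · simp only [sub_apply, one_apply_eq_self]
      conv_lhs => enter [1]; rw [← e1]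
      simp
    · rw [Set.disjoint_left]; intro x hx hx'; exact absurd hx.2 (not_lt.2 hx')
  refine cfc_eq_of_spectral_gap (IsSpectralResolution.isSelfAdjoint_function hS)
    (hP.commute_function hS measurableSet_Iic) hc2 hd1
    (hP.le_function hS measurableSet_Iic fun x hx => Real.exp_le_exp.2 (by
      simpa using hx)) ?_ (continuous_ramp _ _) (fun x hx => ramp_of_ge hc1 hx)
    (fun x hx => ramp_of_le hc1 hx)
  intro u
  rw [hcompl u]
  exact hP.function_le hS measurableSet_Ici (fun x hx => Real.exp_le_exp.2 (by
      simpa using hx)) u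

/-- No gap is available at `l`, so `l` is separated from each `l' > l` by a ramp of `S`, which
commutes with `y`, is `1` on `P (Iic l)` and `0` on `P (Ici l')`. Countable additivity then lets
`l'` decrease to `l`. -/
theorem apply_compl_of_commute (hP : IsSpectralResolution A P μ) (hS : IsUnitHeat μ S)
    {y : H →L[ℂ] H} (hy : Commute y S) (l : ℝ) (u : H) :
    P (Set.Ioi l) (y (P (Set.Iic l) u)) = 0 := by
  have hSsa : IsSelfAdjoint S := IsSpectralResolution.isSelfAdjoint_function hS
  have key : ∀ l' : ℝ, l < l' → P (Set.Ici l') (y (P (Set.Iic l) u)) = 0 := by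
    intro l' hl
    have he : Real.exp (-l') < Real.exp (-l) := Real.exp_lt_exp.2 (by linarith)
    obtain ⟨d, hd1, hd2⟩ := exists_between he
    obtain ⟨c, hc1, hc2⟩ := exists_between hd2
    have e1 := cfc_mul_eq_zero_of_lower_bound (h := fun x => 1 - ramp d c x) hSsa
      (hP.commute_function hS (measurableSet_Iic (a := l))) hc2
      (hP.le_function hS measurableSet_Iic fun x hx => Real.exp_le_exp.2 (by simpa using hx))
      (by fun_prop) (fun x hx => by simp [ramp_of_ge hc1 hx])
    have e2 := cfc_mul_eq_zero_of_upper_bound hSsa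
      (hP.commute_function hS (measurableSet_Ici (a := l'))) hd1
      (hP.function_le hS measurableSet_Ici fun x hx => Real.exp_le_exp.2 (by simpa using hx))
      (continuous_ramp d c) (fun x hx => ramp_of_le hc1 hx)
    have hfc : Continuous (ramp d c) := continuous_ramp d c
    rw [cfc_sub (fun _ => (1 : ℝ)) (ramp d c) S continuous_const.continuousOn hfc.continuousOn,
      cfc_const_one ℝ S, sub_mul, one_mul, sub_eq_zero] at e1
    set F := cfc (ramp d c) S
    have hFy : Commute F y := hy.symm.cfc_real _
    have hFP : Commute F (P (Set.Ici l')) :=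
      (hP.commute_function hS measurableSet_Ici).symm.cfc_real _
    have : P (Set.Ici l') * y * P (Set.Iic l) = 0 := by
      rw [e1, ← mul_assoc, mul_assoc _ y, ← hFy.eq, ← mul_assoc, ← hFP.eq, e2, zero_mul, zero_mul]
    exact congrArg (fun T : H →L[ℂ] H => T u) this
  rw [hP.eq_zero_iff measurableSet_Ioi]
  have hU : Set.Ioi l ⊆ ⋃ n : ℕ, Set.Ici (l + 1 / (n + 1)) := by
    intro x hx
    obtain ⟨n, hn⟩ := exists_nat_one_div_lt (sub_pos.2 (show l < x from hx))
    exact Set.mem_iUnion.2 ⟨n, show l + 1 / ((n : ℝ) + 1) ≤ x by linarith⟩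
  refine measure_mono_null hU (measure_iUnion_null fun n => ?_)
  rw [← hP.eq_zero_iff measurableSet_Ici]
  exact key _ (by have : (0 : ℝ) < 1 / (n + 1) := by positivity
                  linarith)

/-- Spectral projections commute with everything that commutes with the heat operator. -/
theorem commute_apply_Iic (hP : IsSpectralResolution A P μ) (hS : IsUnitHeat μ S)
    {y : H →L[ℂ] H} (hy : Commute y S) (l : ℝ) : Commute y (P (Set.Iic l)) := by
  have hSsa : IsSelfAdjoint S := IsSpectralResolution.isSelfAdjoint_function hS
  have key : ∀ z : H →L[ℂ] H, Commute z S →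
      z * P (Set.Iic l) = P (Set.Iic l) * z * P (Set.Iic l) := by
    intro z hz
    ext u
    have h1 := hP.apply_compl_of_commute hS hz l u
    have h2 := hP.compl_apply (measurableSet_Iic (a := l)) (z (P (Set.Iic l) u))
    rw [Set.compl_Iic, h1, add_zero] at h2
    exact h2.symm
  have hPsa : star (P (Set.Iic l)) = P (Set.Iic l) := hP.isSelfAdjoint measurableSet_Iic
  have h1 := key y hy
  -- Invariance of the range under `y` and under its adjoint means that the range reduces `y`.
  have h2 := key (star y) (by
    have := congrArg star hy.eq
    rw [star_mul, star_mul, hSsa.star_eq] at this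
    exact this.symm)
  have h3 := congrArg star h2
  simp only [star_mul, star_star, hPsa] at h3
  rw [← mul_assoc, ← h1] at h3
  exact h3.symm

end IsSpectralResolution

end HeatOperator

/-! ### Gaps in the spectrum and vanishing spectral projections. -/

section Gap

open MeasureTheory

variable {H : Type*} [NormedAddCommGroup H] [InnerProductSpace ℂ H] [CompleteSpace H]

theorem IsSelfAdjoint.linearPMap_symmetric {A : H →ₗ.[ℂ] H} (hA : IsSelfAdjoint A)
    (u v : A.domain) : inner ℂ (A u) (v : H) = inner ℂ (u : H) (A v) := by
  have h := LinearPMap.adjoint_isFormalAdjoint hA.dense_domain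
  rw [LinearPMap.isSelfAdjoint_def.1 hA] at h
  exact h u v

theorem IsSelfAdjoint.mem_domain_of_inner {A : H →ₗ.[ℂ] H} (hA : IsSelfAdjoint A)
    {v w : H} (h : ∀ u : A.domain, inner ℂ w (u : H) = inner ℂ v (A u)) :
    ∃ hv : v ∈ A.domain, A ⟨v, hv⟩ = w := by
  have h1 : ∃ hv : v ∈ (LinearPMap.adjoint A).domain, LinearPMap.adjoint A ⟨v, hv⟩ = w :=
    ⟨LinearPMap.mem_adjoint_domain_of_exists v ⟨w, h⟩,
      LinearPMap.adjoint_apply_eq hA.dense_domain _ h⟩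
  rwa [LinearPMap.isSelfAdjoint_def.1 hA] at h1

/-- A self-adjoint operator is invertible as soon as it is bounded below. -/
theorem isResolventPoint_of_bounded_below {A : H →ₗ.[ℂ] H} (hA : IsSelfAdjoint A) (x : ℝ) {δ : ℝ}
    (hδ : 0 < δ) (h : ∀ u : A.domain, δ * ‖(u : H)‖ ≤ ‖A u - (x : ℂ) • (u : H)‖) :
    IsResolventPoint A x := by
  set B : A.domain →ₗ[ℂ] H := A.toFun - (x : ℂ) • A.domain.subtype with hB
  have hBu : ∀ u : A.domain, B u = A u - (x : ℂ) • (u : H) := fun u => rfl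
  have hinj : Function.Injective B := by
    rw [injective_iff_map_eq_zero]
    intro u hu
    have h1 := h u
    rw [← hBu, hu, norm_zero] at h1
    have : ‖(u : H)‖ ≤ 0 := by nlinarith [norm_nonneg (u : H)]
    exact Subtype.ext (norm_le_zero_iff.1 this)
  have hclosed : IsClosed (LinearMap.range B : Set H) := by
    have : CompleteSpace A.graph := (hA.isClosed).completeSpace_coe
    -- On the closed graph `A - x` becomes a bounded operator, and the lower bound controls the
    -- graph norm; hence the range is closed.
    let G : A.graph →L[ℂ] H := ((ContinuousLinearMap.snd ℂ H H) -
      (x : ℂ) • ContinuousLinearMap.fst ℂ H H) ∘L A.graph.subtypeL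
    have hG : ∀ u : A.domain, ∀ hu : ((u : H), A u) ∈ A.graph, G ⟨((u : H), A u), hu⟩ = B u :=
      fun u hu => rfl
    have hrange : (LinearMap.range B : Set H) = Set.range G := by
      ext v
      constructor
      · rintro ⟨u, rfl⟩
        exact ⟨⟨((u : H), A u), A.mem_graph u⟩, rfl⟩
      · rintro ⟨⟨⟨a, b⟩, hab⟩, rfl⟩
        obtain ⟨u, hu1, hu2⟩ := (LinearPMap.mem_graph_iff _).1 hab
        simp only at hu1 hu2
        subst hu1 hu2
        exact ⟨u, rfl⟩
    rw [hrange]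
    refine AntilipschitzWith.isClosed_range (K := ⟨1 + (1 + |x|) / δ, by positivity⟩) ?_
      G.uniformContinuous
    refine ContinuousLinearMap.antilipschitz_of_bound G ?_
    rintro ⟨⟨a, b⟩, hab⟩
    obtain ⟨u, hu1, hu2⟩ := (LinearPMap.mem_graph_iff _).1 hab
    simp only at hu1 hu2
    subst hu1 hu2
    rw [hG u]
    have h1 := h u
    rw [← hBu] at h1
    have h2 : ‖(u : H)‖ ≤ ‖B u‖ / δ := by
      rw [le_div_iff₀ hδ]; linarith
    have h3 : ‖A u‖ ≤ ‖B u‖ + |x| * ‖(u : H)‖ := by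
      have : A u = B u + (x : ℂ) • (u : H) := by rw [hBu]; abel
      rw [this]
      refine (norm_add_le _ _).trans ?_
      rw [norm_smul]; simp
    have h4 : |x| * ‖(u : H)‖ ≤ |x| * (‖B u‖ / δ) :=
      mul_le_mul_of_nonneg_left h2 (abs_nonneg x)
    have h5 : 0 ≤ ‖B u‖ / δ := by positivity
    have h6 : 0 ≤ |x| * (‖B u‖ / δ) := by positivity
    change max ‖(u : H)‖ ‖A u‖ ≤ (1 + (1 + |x|) / δ) * ‖B u‖
    have h7 : (1 + (1 + |x|) / δ) * ‖B u‖ = ‖B u‖ + ‖B u‖ / δ + |x| * (‖B u‖ / δ) := by ring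
    rw [h7]
    have := norm_nonneg (B u)
    exact max_le (by linarith) (by linarith)
  have hsurj : Function.Surjective B := by
    have : CompleteSpace (LinearMap.range B) := hclosed.completeSpace_coe
    -- A vector orthogonal to the range lies in the domain of the adjoint, which is `A`, and
    -- satisfies `Av = xv`; the lower bound kills it.
    rw [← LinearMap.range_eq_top, ← Submodule.orthogonal_eq_bot_iff, Submodule.eq_bot_iff]
    intro v hv
    rw [Submodule.mem_orthogonal'] at hv
    obtain ⟨hvd, hAv⟩ := hA.mem_domain_of_inner (v := v) (w := (x : ℂ) • v) fun u => by
      have := hv (B u) ⟨u, rfl⟩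
      rw [hBu, inner_sub_right, inner_smul_right, sub_eq_zero] at this
      rw [this, inner_smul_left]; simp
    have := h ⟨v, hvd⟩
    rw [hAv] at this
    simp only [sub_self, norm_zero] at this
    exact norm_le_zero_iff.1 (by nlinarith [norm_nonneg v])
  let e := LinearEquiv.ofBijective B ⟨hinj, hsurj⟩
  have he : ∀ v, B (e.symm v) = v := fun v => e.apply_symm_apply v
  refine ⟨(A.domain.subtype ∘ₗ (e.symm : H →ₗ[ℂ] A.domain)).mkContinuous δ⁻¹ fun v => ?_,
    fun u => ?_, fun v => ⟨(e.symm v).2, he v⟩⟩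
  · have := h (e.symm v)
    rw [← hBu, he] at this
    change ‖((e.symm v : A.domain) : H)‖ ≤ _
    rw [← div_eq_inv_mul, le_div_iff₀ hδ]
    linarith
  · change ((e.symm (B u) : A.domain) : H) = u
    rw [show B u = e u from rfl, e.symm_apply_apply]

namespace IsSpectralResolution

variable {A : H →ₗ.[ℂ] H} {P : Set ℝ → H →L[ℂ] H} {μ : H → Measure ℝ}

/-- Split `u = a + b` into its parts below and above the gap and test `(A - x)u` against `b - a`,
which has the norm of `u`: both diagonal terms contribute with the good sign, and Cauchy–Schwarz
gives `‖(A - x)u‖ ≥ δ‖u‖`. -/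
theorem isResolventPoint_of_gap (hP : IsSpectralResolution A P μ) (hA : IsSelfAdjoint A)
    {l l' x : ℝ} (hl : l < x) (hl' : x < l') (hgap : P (Set.Ioc l l') = 0) :
    IsResolventPoint A x := by
  set δ := min (x - l) (l' - x)
  have hδ : 0 < δ := lt_min (by linarith) (by linarith)
  have hδ1 : δ ≤ x - l := min_le_left _ _
  have hδ2 : δ ≤ l' - x := min_le_right _ _
  refine isResolventPoint_of_bounded_below hA x hδ fun u => ?_
  have hs : MeasurableSet (Set.Iic l) := measurableSet_Iic
  set a : A.domain := ⟨P (Set.Iic l) u, hP.apply_mem_domain hs u.2⟩ with ha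
  set b : A.domain := ⟨P (Set.Iic l)ᶜ u, hP.apply_mem_domain hs.compl u.2⟩ with hb
  have hu : u = a + b := Subtype.ext (hP.compl_apply hs u).symm
  have hbr : P (Set.Ioi l') b = b := by
    have h1 : (Set.Iic l)ᶜ = Set.Ioc l l' ∪ Set.Ioi l' := by
      rw [Set.compl_Iic, Set.Ioc_union_Ioi_eq_Ioi (by linarith)]
    have h2 : P (Set.Iic l)ᶜ u = P (Set.Ioi l') u := by
      rw [h1, hP.add_of_disjoint measurableSet_Ioc measurableSet_Ioi, hgap]
      · simp
      · rw [Set.disjoint_left]; intro y hy hy'; exact absurd hy.2 (not_le.2 hy')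
    rw [hb]; simp only
    rw [h2, hP.apply_self measurableSet_Ioi]
  have h1 := hP.form_le hs a (hP.apply_self hs _) (l := l) fun y hy => hy
  have h2 := hP.le_form measurableSet_Ioi b hbr (l := l') fun y hy => le_of_lt hy
  have hAa : P (Set.Iic l) (A a) = A a := by
    rw [ha, hP.map_apply hA hs, hP.apply_self hs]
  have hAb : P (Set.Iic l)ᶜ (A b) = A b := by
    rw [hb, hP.map_apply hA hs.compl, hP.apply_self hs.compl]
  have o1 : inner ℂ (A a) (b : H) = 0 := by
    rw [← hAa]; exact hP.inner_apply_apply hs hs.compl disjoint_compl_right _ _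
  have o2 : inner ℂ (A b) (a : H) = 0 := by
    rw [← hAb]; exact hP.inner_apply_apply hs.compl hs disjoint_compl_left _ _
  have o3 : inner ℂ (a : H) (b : H) = 0 :=
    hP.inner_apply_apply hs hs.compl disjoint_compl_right _ _
  have o4 : inner ℂ (b : H) (a : H) = 0 :=
    hP.inner_apply_apply hs.compl hs disjoint_compl_left _ _
  have hn : ‖(a : H)‖ ^ 2 + ‖(b : H)‖ ^ 2 = ‖(u : H)‖ ^ 2 := hP.norm_sq_add_compl hs u
  have hn' : ‖(b : H) - a‖ ^ 2 = ‖(u : H)‖ ^ 2 := by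
    rw [← hn, @norm_sub_sq ℂ, o4]; simp; ring
  have hn'' : ‖(b : H) - a‖ = ‖(u : H)‖ := by
    rwa [sq_eq_sq₀ (norm_nonneg _) (norm_nonneg _)] at hn'
  have hin : (inner ℂ (A u - (x : ℂ) • (u : H)) ((b : H) - a)).re =
      (inner ℂ (A b) (b : H)).re - x * ‖(b : H)‖ ^ 2 -
        ((inner ℂ (A a) (a : H)).re - x * ‖(a : H)‖ ^ 2) := by
    rw [hu, A.map_add, Submodule.coe_add]
    simp only [inner_sub_left, inner_add_left, inner_sub_right, inner_smul_left, o1, o2, o3, o4,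
      smul_add, Complex.conj_ofReal, Complex.sub_re, Complex.add_re, Complex.re_ofReal_mul,
      inner_self_re_eq_norm_sq, mul_zero, Complex.zero_re]
    ring
  have hCS : (inner ℂ (A u - (x : ℂ) • (u : H)) ((b : H) - a)).re ≤
      ‖A u - (x : ℂ) • (u : H)‖ * ‖(u : H)‖ := by
    rw [← hn'']
    exact (Complex.re_le_norm _).trans (norm_inner_le_norm _ _)
  rcases (norm_nonneg (u : H)).eq_or_lt with h0 | h0
  · rw [← h0]; simp
  · have ha2 := sq_nonneg ‖(a : H)‖
    have hb2 := sq_nonneg ‖(b : H)‖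
    have : δ * ‖(u : H)‖ ^ 2 ≤ ‖A u - (x : ℂ) • (u : H)‖ * ‖(u : H)‖ := by
      nlinarith
    rw [sq, ← mul_assoc] at this
    exact le_of_mul_le_mul_right this h0

/-- Near a resolvent point `x` the spectral subspace of `(x - δ, x + δ)` satisfies `‖(A - x)w‖ ≤
δ‖w‖`, which contradicts the bounded inverse `R` when `‖R‖δ < 1`, unless `w = 0`. Local nullity of
the scalar measures gives the whole interval. -/
theorem apply_Ioo_eq_zero_of_resolvent (hP : IsSpectralResolution A P μ) (hA : IsSelfAdjoint A)
    {a b : ℝ} (h : ∀ x : ℝ, a < x → x < b → IsResolventPoint A x) : P (Set.Ioo a b) = 0 := by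
  ext u
  rw [zero_apply, hP.eq_zero_iff measurableSet_Ioo]
  refine measure_null_of_locally_null _ fun x hx => ?_
  obtain ⟨R, hR, -⟩ := h x hx.1 hx.2
  set δ : ℝ := (‖R‖ + 1)⁻¹ with hδd
  have hδ : 0 < δ := by positivity
  have hRδ : ‖R‖ * δ < 1 := by
    rw [hδd, ← div_eq_mul_inv, div_lt_one (by positivity)]; linarith
  set s := Set.Ioo (x - δ) (x + δ) with hsd
  have hs : MeasurableSet s := measurableSet_Ioo
  refine ⟨s, mem_nhdsWithin_of_mem_nhds (Ioo_mem_nhds (by linarith) (by linarith)), ?_⟩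
  rw [← hP.eq_zero_iff hs]
  have hdom : ∀ w, P s w = w → w ∈ A.domain := by
    intro w hw
    have := hP.isFiniteMeasure w
    refine hP.mem_domain_of_bounded hs hw (integrable_const ((|x| + δ) ^ 2)) fun y hy => ?_
    rw [← sq_abs y]
    have : |y| ≤ |x| + δ := by
      have h1 : |y - x| ≤ δ := abs_le.2 ⟨by linarith [hy.1], by linarith [hy.2]⟩
      have h2 := abs_sub_abs_le_abs_sub y x
      linarith
    gcongr
  set w := P s u with hwd
  have hw : P s w = w := hP.apply_self hs u
  set v := A ⟨w, hdom w hw⟩ - (x : ℂ) • w with hvd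
  have hv : P s v = v := by
    rw [hvd, map_sub, map_smul, hw, ← hP.map_apply hA hs]
    simp only [hw]
  have hform : ∀ z (hz : P s z = z), |(inner ℂ (A ⟨z, hdom z hz⟩ - (x : ℂ) • z) z).re| ≤
      δ * ‖z‖ ^ 2 := by
    intro z hz
    have h1 := hP.form_le hs ⟨z, hdom z hz⟩ hz (l := x + δ) fun y hy => hy.2.le
    have h2 := hP.le_form hs ⟨z, hdom z hz⟩ hz (l := x - δ) fun y hy => hy.1.le
    simp only [inner_sub_left, inner_smul_left, Complex.conj_ofReal, Complex.sub_re,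
      Complex.re_ofReal_mul, inner_self_re_eq_norm_sq] at h1 h2 ⊢
    rw [abs_le]
    constructor <;> linarith
  have hnorm : ‖v‖ ≤ δ * ‖w‖ := by
    -- Passing from the form bound to the norm bound by polarization of `w ± tv`; with `δt = 1` the
    -- term in `‖v‖²` on the right is half of the one on the left.
    set t : ℝ := δ⁻¹ with ht
    have htpos : 0 < t := by positivity
    have hz1 : P s (w + (t : ℂ) • v) = w + (t : ℂ) • v := by rw [map_add, map_smul, hw, hv]
    have hz2 : P s (w - (t : ℂ) • v) = w - (t : ℂ) • v := by rw [map_sub, map_smul, hw, hv]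
    have f1 := (abs_le.1 (hform _ hz1)).2
    have f2 := (abs_le.1 (hform _ hz2)).1
    have e1 : A ⟨w + (t : ℂ) • v, hdom _ hz1⟩ =
        A ⟨w, hdom w hw⟩ + (t : ℂ) • A ⟨v, hdom v hv⟩ := by
      rw [← A.map_smul, ← A.map_add]; rfl
    have e2 : A ⟨w - (t : ℂ) • v, hdom _ hz2⟩ =
        A ⟨w, hdom w hw⟩ - (t : ℂ) • A ⟨v, hdom v hv⟩ := by
      rw [← A.map_smul, ← A.map_sub]; rfl
    have hsym := hA.linearPMap_symmetric ⟨v, hdom v hv⟩ ⟨w, hdom w hw⟩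
    have hAw : A ⟨w, hdom w hw⟩ = v + (x : ℂ) • w := by rw [hvd]; abel
    simp only [hAw] at hsym
    have hp := parallelogram_law_with_norm ℂ w ((t : ℂ) • v)
    have hnt : ‖(t : ℂ) • v‖ = t * ‖v‖ := by
      rw [norm_smul]; simp [abs_of_pos htpos]
    rw [hnt] at hp
    have key : (inner ℂ (A ⟨w + (t : ℂ) • v, hdom _ hz1⟩ - (x : ℂ) • (w + (t : ℂ) • v))
          (w + (t : ℂ) • v)).re -
        (inner ℂ (A ⟨w - (t : ℂ) • v, hdom _ hz2⟩ - (x : ℂ) • (w - (t : ℂ) • v))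
          (w - (t : ℂ) • v)).re = 4 * t * ‖v‖ ^ 2 := by
      rw [e1, e2, hAw]
      have hc : (inner ℂ w v : ℂ).re = (inner ℂ v w : ℂ).re := inner_re_symm (𝕜 := ℂ) w v
      have hsr := congrArg Complex.re hsym
      simp only [inner_sub_left, inner_add_left, inner_add_right, inner_sub_right, inner_smul_left,
        inner_smul_right, smul_add, smul_sub, Complex.conj_ofReal, Complex.sub_re, Complex.add_re,
        Complex.re_ofReal_mul, inner_self_re_eq_norm_sq, hc] at hsr ⊢
      linear_combination 2 * t * hsr
    have h3 : 4 * t * ‖v‖ ^ 2 ≤ 2 * δ * (‖w‖ ^ 2 + (t * ‖v‖) ^ 2) := by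
      nlinarith
    have hδt : δ * t = 1 := mul_inv_cancel₀ hδ.ne'
    have h4 : ‖v‖ ^ 2 ≤ (δ * ‖w‖) ^ 2 := by
      have : 2 * δ * (t * ‖v‖) ^ 2 = 2 * t * ‖v‖ ^ 2 := by
        linear_combination 2 * t * ‖v‖ ^ 2 * hδt
      have h5 : t * ‖v‖ ^ 2 ≤ δ * ‖w‖ ^ 2 := by nlinarith
      have h6 := mul_le_mul_of_nonneg_left h5 hδ.le
      rw [← mul_assoc, hδt, one_mul] at h6
      nlinarith
    exact (sq_le_sq₀ (norm_nonneg _) (by positivity)).1 h4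
  have hRv : R v = w := hR ⟨w, hdom w hw⟩
  have h5 : ‖w‖ ≤ ‖R‖ * δ * ‖w‖ := by
    conv_lhs => rw [← hRv]
    refine (R.le_opNorm v).trans ?_
    rw [mul_assoc]
    exact mul_le_mul_of_nonneg_left hnorm (norm_nonneg _)
  have : ‖w‖ ≤ 0 := by nlinarith [norm_nonneg w]
  exact norm_le_zero_iff.1 this

end IsSpectralResolution

end Gap

/-! ### IMS localization and transfer of low-energy vectors. -/

section Localization

open MeasureTheory

variable {H : Type*} [NormedAddCommGroup H] [InnerProductSpace ℂ H] [CompleteSpace H]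

theorem inner_doubleCommutator {A : H →ₗ.[ℂ] H} {J : H →L[ℂ] H} (hJ : IsSelfAdjoint J)
    (hd : ∀ u ∈ A.domain, J u ∈ A.domain) (u : A.domain) :
    inner ℂ (doubleCommutator A J hd u) (u : H) =
      inner ℂ (J (J (A u))) (u : H) + inner ℂ (A ⟨J (J u), hd _ (hd _ u.2)⟩) (u : H) -
        2 * inner ℂ (A ⟨J u, hd _ u.2⟩) (J u) := by
  have h1 : inner ℂ (J (A ⟨J u, hd _ u.2⟩)) (u : H) = inner ℂ (A ⟨J u, hd _ u.2⟩) (J u) :=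
    hJ.inner_map_left _ _
  simp only [doubleCommutator, map_sub, inner_sub_left]
  rw [h1]
  ring

namespace IsCutoffLocalized

variable {A : H →ₗ.[ℂ] H} {J J' : H →L[ℂ] H} {l₀ γ α : ℝ}

/-- The IMS localization formula, in the form of a lower bound. -/
theorem localization (h : IsCutoffLocalized A J J' l₀ γ α) (u : A.domain) :
    (inner ℂ (A ⟨J u, h.cutoff_domain u u.2⟩) (J u)).re +
      (inner ℂ (A ⟨J' u, h.compl_domain u u.2⟩) (J' u)).re - γ * ‖(u : H)‖ ^ 2 ≤
      (inner ℂ (A u) (u : H)).re := by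
  obtain ⟨C, hC, hCu⟩ := h.commutator_bound
  obtain ⟨C', hC', hCu'⟩ := h.compl_commutator_bound
  have e1 := inner_doubleCommutator h.cutoff_selfAdjoint h.cutoff_domain u
  have e2 := inner_doubleCommutator h.compl_selfAdjoint h.compl_domain u
  rw [← hCu] at e1
  rw [← hCu'] at e2
  have hpart : ∀ v : H, J (J v) + J' (J' v) = v := fun v =>
    congrArg (fun T : H →L[ℂ] H => T v) h.partition
  have s1 : inner ℂ (J (J (A u))) (u : H) + inner ℂ (J' (J' (A u))) (u : H) =
      inner ℂ (A u) (u : H) := by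
    rw [← inner_add_left, hpart]
  have s2 : inner ℂ (A ⟨J (J u), h.cutoff_domain _ (h.cutoff_domain _ u.2)⟩) (u : H) +
      inner ℂ (A ⟨J' (J' u), h.compl_domain _ (h.compl_domain _ u.2)⟩) (u : H) =
      inner ℂ (A u) (u : H) := by
    rw [← inner_add_left, ← A.map_add]
    congr 2
    exact Subtype.ext (hpart u)
  have bound : ∀ D : H →L[ℂ] H, ‖D‖ ≤ γ → -(γ * ‖(u : H)‖ ^ 2) ≤ (inner ℂ (D u) (u : H)).re := by
    intro D hD
    have h1 : ‖inner ℂ (D u) (u : H)‖ ≤ γ * ‖(u : H)‖ ^ 2 :=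
      calc _ ≤ ‖D u‖ * ‖(u : H)‖ := norm_inner_le_norm _ _
        _ ≤ (γ * ‖(u : H)‖) * ‖(u : H)‖ := by
          gcongr
          exact D.le_of_opNorm_le hD _
        _ = _ := by ring
    exact (abs_le.1 ((Complex.abs_re_le_norm _).trans h1)).1
  have b1 := bound C hC
  have b2 := bound C' hC'
  -- This is `2A - 2JAJ - 2J'AJ' = [J,[J,A]] + [J',[J',A]]` as forms; two errors of size `γ`,
  -- halved, leave a single `γ`.
  have := congrArg Complex.re (show inner ℂ (C u) (u : H) + inner ℂ (C' u) (u : H) =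
    2 * inner ℂ (A u) (u : H) - 2 * inner ℂ (A ⟨J u, h.cutoff_domain u u.2⟩) (J u) -
      2 * inner ℂ (A ⟨J' u, h.compl_domain u u.2⟩) (J' u) by
    rw [e1, e2]; linear_combination s1 + s2)
  simp only [Complex.add_re, Complex.sub_re, Complex.mul_re, Complex.re_ofNat, Complex.im_ofNat,
    zero_mul, sub_zero] at this
  linarith

theorem norm_sq_add (h : IsCutoffLocalized A J J' l₀ γ α) (u : H) :
    ‖J u‖ ^ 2 + ‖J' u‖ ^ 2 = ‖u‖ ^ 2 := by
  have e : inner ℂ (J u) (J u) + inner ℂ (J' u) (J' u) = inner ℂ u u := by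
    rw [h.cutoff_selfAdjoint.inner_map_left, h.compl_selfAdjoint.inner_map_left, ← inner_add_right]
    congr 1
    exact congrArg (fun T : H →L[ℂ] H => T u) h.partition
  have := congrArg Complex.re e
  rwa [Complex.add_re, inner_self_re_eq_norm_sq, inner_self_re_eq_norm_sq,
    inner_self_re_eq_norm_sq] at this

theorem gamma_nonneg (h : IsCutoffLocalized A J J' l₀ γ α) : 0 ≤ γ := by
  obtain ⟨C, hC, -⟩ := h.commutator_bound
  exact (norm_nonneg C).trans hC

theorem form_cutoff_le (h : IsCutoffLocalized A J J' l₀ γ α) {l : ℝ} (hl : l + γ < α)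
    (u : A.domain) (hu : (inner ℂ (A u) (u : H)).re ≤ l * ‖(u : H)‖ ^ 2) :
    (inner ℂ (A ⟨J u, h.cutoff_domain u u.2⟩) (J u)).re ≤ (l + γ) * ‖J u‖ ^ 2 := by
  have h1 := h.localization u
  have h2 := h.lower_bound u
  have h3 := h.norm_sq_add u
  rw [← h3] at hu h1
  nlinarith [sq_nonneg ‖J' u‖]

/-- Localization gives `l₀‖Ju‖² + α‖J'u‖² ≤ (l + γ)‖u‖²`; eliminating `J'u` by `‖Ju‖² + ‖J'u‖² =
‖u‖²` bounds `‖Ju‖` from below. -/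
theorem norm_sq_le_cutoff (h : IsCutoffLocalized A J J' l₀ γ α) {l : ℝ}
    (u : A.domain) (hu : (inner ℂ (A u) (u : H)).re ≤ l * ‖(u : H)‖ ^ 2) :
    (α - (l + γ)) * ‖(u : H)‖ ^ 2 ≤ (α - l₀) * ‖J u‖ ^ 2 := by
  have h1 := h.localization u
  have h2 := h.lower_bound u
  have h4 : l₀ * ‖J u‖ ^ 2 ≤ (inner ℂ (A ⟨J u, h.cutoff_domain u u.2⟩) (J u)).re :=
    h.semibounded ⟨J u, h.cutoff_domain u u.2⟩
  have h3 := h.norm_sq_add u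
  rw [← h3] at hu h1 ⊢
  nlinarith

end IsCutoffLocalized

variable {K : Type*} [NormedAddCommGroup K] [InnerProductSpace ℂ K] [CompleteSpace K]

/-- A map that intertwines localized quadratic forms carries the low-energy subspace of one
operator injectively, with a lower bound, into the low-energy subspace of the other one. -/
theorem IsCutoffLocalized.le_norm_sq_apply {A : H →ₗ.[ℂ] H} {J J' : H →L[ℂ] H} {l₀ γ α : ℝ}
    (h : IsCutoffLocalized A J J' l₀ γ α) {B : K →ₗ.[ℂ] K} {P : Set ℝ → K →L[ℂ] K}
    {μ : K → Measure ℝ} (hP : IsSpectralResolution B P μ) {m₀ : ℝ}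
    (hB : ∀ w : B.domain, m₀ * ‖(w : K)‖ ^ 2 ≤ (inner ℂ (B w) (w : K)).re)
    {X : H →L[ℂ] K} (hX : ∀ u, ‖X u‖ = ‖J u‖)
    (hXd : ∀ u, J u ∈ A.domain → X u ∈ B.domain) {β ε : ℝ} (hβ : 0 ≤ β)
    (hform : ∀ (u : H) (h₁ : J u ∈ A.domain) (h₂ : X u ∈ B.domain),
      (inner ℂ (B ⟨X u, h₂⟩) (X u)).re ≤
        β * (inner ℂ (A ⟨J u, h₁⟩) (J u)).re + ε * ‖J u‖ ^ 2)
    {l m' : ℝ} (hl : l + γ < α)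
    (hm : β * (l + γ) + ε < m') {s : Set ℝ} (hs : MeasurableSet s)
    (hs' : ∀ w, P (Set.Ici m') (P sᶜ w) = P sᶜ w)
    (u : A.domain) (hu : (inner ℂ (A u) (u : H)).re ≤ l * ‖(u : H)‖ ^ 2) :
    (m' - (β * (l + γ) + ε)) * (α - (l + γ)) * ‖(u : H)‖ ^ 2 ≤
      (m' - m₀) * (α - l₀) * ‖P s (X u)‖ ^ 2 := by
  have h1 := h.form_cutoff_le hl u hu
  have h2 := h.norm_sq_le_cutoff u hu
  have hJd := h.cutoff_domain u u.2
  have h3 := hform u hJd (hXd _ hJd)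
  have h4 := hP.re_form_split hs ⟨X u, hXd _ hJd⟩
  have h5 := hB ⟨P s (X u), hP.apply_mem_domain hs (hXd _ hJd)⟩
  have h6 : m' * ‖P sᶜ (X u)‖ ^ 2 ≤
      (inner ℂ (B ⟨P sᶜ (X u), hP.apply_mem_domain hs.compl (hXd _ hJd)⟩) (P sᶜ (X u))).re := by
    exact hP.le_form measurableSet_Ici ⟨P sᶜ (X u), _⟩ (hs' _) fun x hx => hx
  have h7 := hP.norm_sq_add_compl hs (X u)
  simp only at h4 h5
  rw [← hX u] at h1 h2 h3
  have h8 := mul_le_mul_of_nonneg_left h1 hβ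
  set a := ‖P s (X u)‖ ^ 2
  set b := ‖P sᶜ (X u)‖ ^ 2
  set n := ‖X u‖ ^ 2
  -- The image has energy at most `β(l + γ) + ε` per unit of norm squared, whereas its part outside
  -- `s` has at least `m'` and its part in `s` at least `m₀`.
  have h9 : (m' - (β * (l + γ) + ε)) * n ≤ (m' - m₀) * a := by
    have : m₀ * a + m' * b ≤ β * ((l + γ) * n) + ε * n := by linarith
    rw [← h7] at this ⊢
    linarith
  have hn : 0 ≤ n := by positivity
  -- The sign of `α - l₀` is not assumed; if it were negative, `h2` would force `Xu = 0`.
  have hα : 0 ≤ α - l₀ ∨ n = 0 := by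
    by_contra hcon
    push Not at hcon
    have hn' : 0 < n := lt_of_le_of_ne hn (Ne.symm hcon.2)
    have : 0 ≤ (α - (l + γ)) * ‖(u : H)‖ ^ 2 := by
      have : 0 ≤ α - (l + γ) := by linarith
      positivity
    nlinarith [hcon.1]
  have h10 := mul_le_mul_of_nonneg_left h2 (show 0 ≤ m' - (β * (l + γ) + ε) by linarith)
  rcases hα with hα | hn0
  · have h11 := mul_le_mul_of_nonneg_left h9 hα
    linarith
  · have ha : 0 ≤ a := by positivity
    have hb : 0 ≤ b := by positivity
    have ha0 : a = 0 := by linarith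
    rw [ha0]
    rw [hn0] at h10
    linarith

end Localization

/-! ### Finiteness and faithfulness of the trace. -/

section Trace

variable {H : Type*} [NormedAddCommGroup H] [InnerProductSpace ℂ H] [CompleteSpace H]

theorem IsFaithfulNormalSemifiniteTrace.eq_zero_of_add {M : VonNeumannAlgebra H}
    {τ : (H →L[ℂ] H) → ℝ≥0∞} (hτ : IsFaithfulNormalSemifiniteTrace M τ) {x d : H →L[ℂ] H}
    (hx : x ∈ M) (hd : d ∈ M) (hx0 : 0 ≤ x) (hd0 : 0 ≤ d) (hfin : τ x < ∞)
    (h : τ (x + d) = τ x) : d = 0 := by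
  refine hτ.faithful d hd hd0 ?_
  rw [hτ.add x hx d hd hx0 hd0] at h
  exact (ENNReal.add_right_inj hfin.ne).1 (h.trans (add_zero _).symm)

theorem IsFaithfulNormalSemifiniteTrace.lt_top_of_smul_le {M : VonNeumannAlgebra H}
    {τ : (H →L[ℂ] H) → ℝ≥0∞} (hτ : IsFaithfulNormalSemifiniteTrace M τ) {x y : H →L[ℂ] H}
    (hx : x ∈ M) (hy : y ∈ M) (hx0 : 0 ≤ x) {r : ℝ≥0} (hr : 0 < r)
    (hxy : ((r : ℝ) : ℂ) • x ≤ y) (hfin : τ y < ∞) : τ x < ∞ := by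
  have hrx : ((r : ℝ) : ℂ) • x ∈ M := M.toStarSubalgebra.smul_mem hx _
  have hrx0 : 0 ≤ ((r : ℝ) : ℂ) • x := by
    rw [Complex.coe_smul]
    exact smul_nonneg r.2 hx0
  have h1 := hτ.add _ hrx (y - ((r : ℝ) : ℂ) • x) (M.toStarSubalgebra.sub_mem hy hrx) hrx0
    (sub_nonneg.2 hxy)
  rw [add_sub_cancel, hτ.smul r x hx hx0] at h1
  have h2 : (r : ℝ≥0∞) * τ x < ∞ := lt_of_le_of_lt (by rw [h1]; exact le_self_add) hfin
  by_contra hcon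
  rw [not_lt, top_le_iff] at hcon
  rw [hcon, ENNReal.mul_top (by exact_mod_cast hr.ne')] at h2
  exact lt_irrefl _ h2

end Trace

/-! ### Functional calculus in `π(𝔄)` and in its bicommutant. -/

section Representation

variable {𝔄 H : Type*} [NonUnitalCStarAlgebra 𝔄]
  [NormedAddCommGroup H] [InnerProductSpace ℂ H] [CompleteSpace H]

theorem mem_bicommutant_iff {π : 𝔄 →⋆ₙₐ[ℂ] (H →L[ℂ] H)} {x : H →L[ℂ] H} :
    x ∈ bicommutant π ↔ ∀ y ∈ Set.centralizer (Set.range π), Commute y x := by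
  rw [← SetLike.mem_coe, coe_bicommutant]
  rfl

theorem map_mem_bicommutant (π : 𝔄 →⋆ₙₐ[ℂ] (H →L[ℂ] H)) (a : 𝔄) : π a ∈ bicommutant π :=
  mem_bicommutant_iff.2 fun _ hy => (hy _ ⟨a, rfl⟩).symm

theorem cfcₙ_mem_bicommutant {π : 𝔄 →⋆ₙₐ[ℂ] (H →L[ℂ] H)} {x : H →L[ℂ] H}
    (hx : x ∈ bicommutant π) (f : ℝ → ℝ) : cfcₙ f x ∈ bicommutant π :=
  mem_bicommutant_iff.2 fun y hy => ((mem_bicommutant_iff.1 hx y hy).symm.cfcₙ_real f).symm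

theorem unitaryTransport_eq_conj {K : Type*} [NormedAddCommGroup K] [InnerProductSpace ℂ K]
    [CompleteSpace K] (V : H ≃ₗᵢ[ℂ] K) (T : H →L[ℂ] H) :
    unitaryTransport V T = V.conjStarAlgEquiv T := rfl

theorem map_cfcₙ_of_isSelfAdjoint (π : 𝔄 →⋆ₙₐ[ℂ] (H →L[ℂ] H)) {f : ℝ → ℝ} (hf : Continuous f)
    (hf0 : f 0 = 0) {s : 𝔄} (hs : IsSelfAdjoint s) : π (cfcₙ f s) = cfcₙ f (π s) :=
  NonUnitalStarAlgHomClass.map_cfcₙ (R := ℝ) (S := ℂ) π f s hf.continuousOn hf0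
    (AddMonoidHomClass.continuous_of_bound π 1 fun a => by
      simpa using NonUnitalStarAlgHom.norm_apply_le π a) hs (hs.map π)

theorem IsStarProjection.of_map_injective {π : 𝔄 →⋆ₙₐ[ℂ] (H →L[ℂ] H)}
    (hπ : Function.Injective π) {e : 𝔄} (h : IsStarProjection (π e)) : IsStarProjection e where
  isIdempotentElem := hπ (by rw [map_mul]; exact h.isIdempotentElem)
  isSelfAdjoint := hπ (by rw [map_star]; exact h.isSelfAdjoint)

end Representation

/-! ### Partial isometries transported by the unitaries. -/

section Transport

variable {H H₁ H₂ : Type*}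
  [NormedAddCommGroup H] [InnerProductSpace ℂ H] [CompleteSpace H]
  [NormedAddCommGroup H₁] [InnerProductSpace ℂ H₁] [CompleteSpace H₁]
  [NormedAddCommGroup H₂] [InnerProductSpace ℂ H₂] [CompleteSpace H₂]

theorem map_cfc_conj (V : H₁ ≃ₗᵢ[ℂ] H) {S : H₁ →L[ℂ] H₁} (hS : IsSelfAdjoint S) {f : ℝ → ℝ}
    (hf : Continuous f) : V.conjStarAlgEquiv (cfc f S) = cfc f (V.conjStarAlgEquiv S) :=
  StarAlgHomClass.map_cfc (R := ℝ) (S := ℂ) V.conjStarAlgEquiv f S hf.continuousOn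
    (map_continuous (V.conjStarAlgEquiv)) hS (hS.map _)

theorem norm_apply_eq_of_adjoint_comp {X : H₁ →L[ℂ] H₂} {Y : H₂ →L[ℂ] H₁} {J : H₁ →L[ℂ] H₁}
    (hXY : ContinuousLinearMap.adjoint X = Y) (hJ : IsSelfAdjoint J)
    (h : ∀ u, Y (X u) = J (J u)) (u : H₁) : ‖X u‖ = ‖J u‖ := by
  have h1 : inner ℂ (X u) (X u) = inner ℂ (J u) (J u) := by
    rw [← ContinuousLinearMap.adjoint_inner_left, hXY, h, hJ.inner_map_left]
  have h2 := congrArg Complex.re h1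
  rw [inner_self_re_eq_norm_sq, inner_self_re_eq_norm_sq] at h2
  rwa [sq_eq_sq₀ (norm_nonneg _) (norm_nonneg _)] at h2

/-- A map between two Hilbert spaces that is bounded below from the range of `Q₁` to the range
of `Q₂`, with injective adjoint, yields a partial isometry between the transported projections. -/
theorem exists_partial_isometry_conj (V₁ : H₁ ≃ₗᵢ[ℂ] H) (V₂ : H₂ ≃ₗᵢ[ℂ] H) (X : H₁ →L[ℂ] H₂)
    {Q₁ : H₁ →L[ℂ] H₁} {Q₂ : H₂ →L[ℂ] H₂} (hQ₁ : IsStarProjection Q₁) (hQ₂ : IsStarProjection Q₂)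
    {c : ℝ} (hc : 0 < c) (h₁ : ∀ u, Q₁ u = u → c * ‖u‖ ^ 2 ≤ ‖Q₂ (X u)‖ ^ 2)
    (h₂ : ∀ v, Q₂ v = v → Q₁ (ContinuousLinearMap.adjoint X v) = 0 → v = 0)
    {T : H →L[ℂ] H} (hT : T = V₂.conjStarAlgEquiv Q₂ *
      ((V₂ : H₂ →L[ℂ] H) ∘L X ∘L (V₁.symm : H →L[ℂ] H₁)) * V₁.conjStarAlgEquiv Q₁) :
    ∃ g : ℝ → ℝ, Continuous g ∧ g 0 = 0 ∧
      star (T * cfcₙ g (star T * T)) * (T * cfcₙ g (star T * T)) = V₁.conjStarAlgEquiv Q₁ ∧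
      (T * cfcₙ g (star T * T)) * star (T * cfcₙ g (star T * T)) = V₂.conjStarAlgEquiv Q₂ := by
  have hE : IsStarProjection (V₁.conjStarAlgEquiv Q₁) := hQ₁.map _
  have hF : IsStarProjection (V₂.conjStarAlgEquiv Q₂) := hQ₂.map _
  have hi₁ : ∀ u, Q₁ (Q₁ u) = Q₁ u := fun u =>
    congrArg (fun T : H₁ →L[ℂ] H₁ => T u) hQ₁.isIdempotentElem.eq
  have hTu : ∀ u, T u = V₂ (Q₂ (X (Q₁ (V₁.symm u)))) := by
    intro u; rw [hT]; simp
  refine exists_partial_isometry hE hF ?_ ?_ hc ?_ ?_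
  · rw [hT, mul_assoc, hE.isIdempotentElem.eq]
  · rw [hT, ← mul_assoc, ← mul_assoc, hF.isIdempotentElem.eq]
  · intro u
    rw [hTu]
    simp only [LinearIsometryEquiv.conjStarAlgEquiv_apply_apply, LinearIsometryEquiv.norm_map,
      LinearIsometryEquiv.symm_apply_apply, hi₁]
    exact h₁ _ (hi₁ _)
  · intro u hu hTu0
    have hv : Q₂ (V₂.symm u) = V₂.symm u := by
      apply V₂.injective
      simpa using hu
    have h0 : Q₁ (ContinuousLinearMap.adjoint X (V₂.symm u)) = 0 := by
      refine ext_inner_right ℂ fun w => ?_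
      rw [hQ₁.isSelfAdjoint.inner_map_left, ContinuousLinearMap.adjoint_inner_left, inner_zero_left,
        ← hv, hQ₂.isSelfAdjoint.inner_map_left, ← V₂.inner_map_map, V₂.apply_symm_apply]
      have e : V₂ (Q₂ (X (Q₁ w))) = T (V₁ w) := by rw [hTu]; simp
      rw [e, ← ContinuousLinearMap.adjoint_inner_left, ← ContinuousLinearMap.star_eq_adjoint, hTu0,
        inner_zero_left]
    have := h₂ _ hv h0
    simpa using this

end Transport

/-! ### Spectral projections in the algebra and their traces. -/

section HeatTransport

open MeasureTheory

variable {𝔄 H H₁ : Type*} [NonUnitalCStarAlgebra 𝔄]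
  [NormedAddCommGroup H] [InnerProductSpace ℂ H] [CompleteSpace H]
  [NormedAddCommGroup H₁] [InnerProductSpace ℂ H₁] [CompleteSpace H₁]
  {A : H₁ →ₗ.[ℂ] H₁} {P : Set ℝ → H₁ →L[ℂ] H₁} {μ : H₁ → Measure ℝ} {S : H₁ →L[ℂ] H₁}
  {π : 𝔄 →⋆ₙₐ[ℂ] (H →L[ℂ] H)} {V : H₁ ≃ₗᵢ[ℂ] H}

theorem IsHeatOperator.exists_resolution (h : IsHeatOperator A 1 S) :
    ∃ (P : Set ℝ → H₁ →L[ℂ] H₁) (μ : H₁ → Measure ℝ),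
      IsSpectralResolution A P μ ∧ IsUnitHeat μ S := by
  obtain ⟨P, μ, hP, hS⟩ := h
  refine ⟨P, μ, hP, ?_⟩
  simpa only [IsUnitHeat, one_mul] using hS

namespace IsSpectralResolution

/-- Whatever commutes with `π(𝔄)` commutes with the heat operator, hence with its spectral
projections; no gap is needed for the bicommutant. -/
theorem conj_apply_Iic_mem_bicommutant (hP : IsSpectralResolution A P μ) (hS : IsUnitHeat μ S)
    {s : 𝔄} (hs : π s = V.conjStarAlgEquiv S) (l : ℝ) :
    V.conjStarAlgEquiv (P (Set.Iic l)) ∈ bicommutant π := by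
  refine mem_bicommutant_iff.2 fun y hy => ?_
  have h1 : Commute (V.conjStarAlgEquiv.symm y) S := by
    have : Commute y (π s) := (hy _ ⟨s, rfl⟩).symm
    rw [hs] at this
    simpa only [StarAlgEquiv.symm_apply_apply] using this.map V.conjStarAlgEquiv.symm
  simpa only [StarAlgEquiv.apply_symm_apply] using
    (hP.commute_apply_Iic hS h1 l).map V.conjStarAlgEquiv

/-- Spectral projections at a gap lie in the algebra that contains the heat operator. -/
theorem exists_preimage_conj_apply_Iic (hP : IsSpectralResolution A P μ) (hS : IsUnitHeat μ S)
    (hπ : Function.Injective π) {s : 𝔄} (hs : π s = V.conjStarAlgEquiv S) {l l' : ℝ}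
    (hl : l < l') (hgap : P (Set.Ioo l l') = 0) :
    ∃ e : 𝔄, π e = V.conjStarAlgEquiv (P (Set.Iic l)) := by
  obtain ⟨f, hf, hf0, hfP⟩ := hP.exists_cfc_eq hS hl hgap
  have hSsa : IsSelfAdjoint S := isSelfAdjoint_function hS
  have hssa : IsSelfAdjoint s := hπ (by
    rw [map_star, hs]
    exact (hSsa.map V.conjStarAlgEquiv).star_eq)
  refine ⟨cfcₙ f s, ?_⟩
  rw [map_cfcₙ_of_isSelfAdjoint π hf hf0 hssa, hs, cfcₙ_eq_cfc hf.continuousOn hf0,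
    ← map_cfc_conj V hSsa hf, hfP]

theorem smul_apply_Iic_le (hP : IsSpectralResolution A P μ) (hS : IsUnitHeat μ S) (l : ℝ) :
    (Real.exp (-l) : ℂ) • P (Set.Iic l) ≤ S := by
  have hs : MeasurableSet (Set.Iic l) := measurableSet_Iic
  rw [ContinuousLinearMap.le_def]
  refine ContinuousLinearMap.isPositive_iff_complex _ |>.2 fun u => ?_
  have e1 : inner ℂ (P (Set.Iic l) u) u = ((‖P (Set.Iic l) u‖ ^ 2 : ℝ) : ℂ) := by
    conv_lhs => rw [← hP.apply_self hs, (hP.isSelfAdjoint hs).inner_map_left]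
    rw [inner_self_eq_norm_sq_to_K]; simp
  have e2 : inner ℂ ((S - (Real.exp (-l) : ℂ) • P (Set.Iic l)) u) u =
      ((∫ x, Real.exp (-x) ∂(μ u) - Real.exp (-l) * ‖P (Set.Iic l) u‖ ^ 2 : ℝ) : ℂ) := by
    simp only [sub_apply, smul_apply, inner_sub_left, inner_smul_left, e1, (hS u).2,
      Complex.conj_ofReal]
    push_cast; ring
  rw [e2]
  refine ⟨by rw [RCLike.re_to_complex, Complex.ofReal_re], ?_⟩
  have h1 := hP.le_integral hs (hP.apply_self hs u) (hS _).1 (l := Real.exp (-l))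
    fun x hx => Real.exp_le_exp.2 (by simpa using hx)
  rw [hP.measure_apply hs] at h1
  have h2 : ∫ x in Set.Iic l, Real.exp (-x) ∂(μ u) ≤ ∫ x, Real.exp (-x) ∂(μ u) :=
    setIntegral_le_integral (hS u).1 (Filter.Eventually.of_forall fun x => (Real.exp_pos _).le)
  simp only [RCLike.re_to_complex, Complex.ofReal_re]
  linarith

theorem trace_conj_apply_Iic_lt_top (hP : IsSpectralResolution A P μ) (hS : IsUnitHeat μ S)
    {s : 𝔄} (hs : π s = V.conjStarAlgEquiv S) {τ : (H →L[ℂ] H) → ℝ≥0∞}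
    (hτ : IsFaithfulNormalSemifiniteTrace (bicommutant π) τ)
    (hfin : τ (V.conjStarAlgEquiv S) < ∞) (l : ℝ) :
    τ (V.conjStarAlgEquiv (P (Set.Iic l))) < ∞ := by
  refine hτ.lt_top_of_smul_le (hP.conj_apply_Iic_mem_bicommutant hS hs l)
    (hs ▸ map_mem_bicommutant π s)
    ((hP.isStarProjection _ measurableSet_Iic).map V.conjStarAlgEquiv).nonneg
    (r := ⟨Real.exp (-l), (Real.exp_pos _).le⟩) (Real.exp_pos _) ?_ hfin
  rw [← map_smul]
  exact OrderHomClass.mono V.conjStarAlgEquiv (hP.smul_apply_Iic_le hS l)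

/-- The difference of the two nested projections is positive of trace zero. Finiteness is what
allows the common trace to be cancelled. -/
theorem apply_Ioc_eq_zero_of_trace_eq (hP : IsSpectralResolution A P μ) (hS : IsUnitHeat μ S)
    {s : 𝔄} (hs : π s = V.conjStarAlgEquiv S) {τ : (H →L[ℂ] H) → ℝ≥0∞}
    (hτ : IsFaithfulNormalSemifiniteTrace (bicommutant π) τ) {l l' : ℝ} (hl : l ≤ l')
    (hfin : τ (V.conjStarAlgEquiv (P (Set.Iic l))) < ∞)
    (h : τ (V.conjStarAlgEquiv (P (Set.Iic l'))) = τ (V.conjStarAlgEquiv (P (Set.Iic l)))) :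
    P (Set.Ioc l l') = 0 := by
  have e : P (Set.Iic l') = P (Set.Iic l) + P (Set.Ioc l l') := by
    ext u
    rw [add_apply, ← hP.add_of_disjoint measurableSet_Iic measurableSet_Ioc,
      Set.Iic_union_Ioc_eq_Iic hl]
    rw [Set.disjoint_left]
    intro x hx hx'
    exact absurd hx'.1 (not_lt.2 hx)
  have e' : V.conjStarAlgEquiv (P (Set.Ioc l l')) =
      V.conjStarAlgEquiv (P (Set.Iic l')) - V.conjStarAlgEquiv (P (Set.Iic l)) := by
    rw [e, map_add, add_sub_cancel_left]
  have h0 := hτ.eq_zero_of_add (x := V.conjStarAlgEquiv (P (Set.Iic l)))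
    (d := V.conjStarAlgEquiv (P (Set.Ioc l l')))
    (hP.conj_apply_Iic_mem_bicommutant hS hs l)
    (by rw [e']
        exact (bicommutant π).toStarSubalgebra.sub_mem
          (hP.conj_apply_Iic_mem_bicommutant hS hs l')
          (hP.conj_apply_Iic_mem_bicommutant hS hs l))
    ((hP.isStarProjection _ measurableSet_Iic).map V.conjStarAlgEquiv).nonneg
    ((hP.isStarProjection _ measurableSet_Ioc).map V.conjStarAlgEquiv).nonneg hfin
    (by rw [← map_add, ← e, h])
  exact (map_eq_zero_iff _ V.conjStarAlgEquiv.injective).1 h0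

theorem apply_Iic_of_gap (hP : IsSpectralResolution A P μ) {a b l : ℝ} (ha : a < l) (hb : l < b)
    (hgap : P (Set.Ioo a b) = 0) (u : H₁) : P (Set.Iic l) u = P (Set.Iic a) u := by
  have h0 : P (Set.Ioc a l) u = 0 := by
    have : P (Set.Ioc a l) (P (Set.Ioo a b) u) = P (Set.Ioc a l) u := by
      rw [hP.apply_apply measurableSet_Ioc measurableSet_Ioo, Set.inter_eq_left.2]
      exact fun x hx => ⟨hx.1, hx.2.trans_lt hb⟩
    rw [← this, hgap]; simp
  rw [← Set.Iic_union_Ioc_eq_Iic ha.le, hP.add_of_disjoint measurableSet_Iic measurableSet_Ioc,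
    h0, add_zero]
  rw [Set.disjoint_left]
  intro x hx hx'
  exact absurd hx'.1 (not_lt.2 hx)

theorem apply_Ici_compl_of_gap (hP : IsSpectralResolution A P μ) {a b l : ℝ} (ha : a < l)
    (hb : l < b) (hgap : P (Set.Ioo a b) = 0) (u : H₁) :
    P (Set.Ici b) (P (Set.Iic l)ᶜ u) = P (Set.Iic l)ᶜ u := by
  have h0 : P (Set.Ioo l b) u = 0 := by
    have : P (Set.Ioo l b) (P (Set.Ioo a b) u) = P (Set.Ioo l b) u := by
      rw [hP.apply_apply measurableSet_Ioo measurableSet_Ioo, Set.inter_eq_left.2]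
      exact fun x hx => ⟨ha.trans hx.1, hx.2⟩
    rw [← this, hgap]; simp
  have h1 : P (Set.Iic l)ᶜ u = P (Set.Ici b) u := by
    rw [Set.compl_Iic, ← Set.Ioo_union_Ici_eq_Ioi hb,
      hP.add_of_disjoint measurableSet_Ioo measurableSet_Ici, h0, zero_add]
    rw [Set.disjoint_left]
    intro x hx hx'
    exact absurd hx.2 (not_lt.2 hx')
  rw [h1, hP.apply_self measurableSet_Ici]

end IsSpectralResolution

end HeatTransport

/-! ### What the formulas for `a₂` and `b₂` provide. -/

section Endpoints

/-- The quadratic term is nonnegative and may be dropped. Since `a' ≥ 0`, the bracket is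
nonnegative, and the factor `ρ ≥ 1` only enlarges it. -/
theorem le_left_endpoint {l₀ γ α β ε ρ a a' : ℝ} (hβ : 0 ≤ β) (hρ : 1 ≤ ρ) (hα : 0 ≤ α - a - γ)
    (ha' : a' = ρ * (β * (a + γ + (a + γ - l₀) ^ 2 / (α - a - γ)) + ε)) (h0 : 0 ≤ a') :
    β * (a + γ) + ε ≤ a' := by
  have hq : 0 ≤ β * ((a + γ - l₀) ^ 2 / (α - a - γ)) := by positivity
  set q := (a + γ - l₀) ^ 2 / (α - a - γ)
  have hy : 0 ≤ β * (a + γ + q) + ε := by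
    by_contra hcon
    have := mul_neg_of_pos_of_neg (show 0 < ρ by linarith) (not_le.1 hcon)
    linarith
  have := le_mul_of_one_le_left hy hρ
  linarith

theorem right_endpoint_le {l₀ γ α β ε ρ b b' : ℝ} (hβ : 0 < β) (hρ : 1 < ρ) (hε : 0 ≤ ε)
    (hγ : 0 ≤ γ) (h0 : 0 < b') (hα : b' + γ < α)
    (hb' : b' = (β⁻¹ * (b * ρ⁻¹ - ε) * (α - γ) - α * γ + 2 * l₀ * γ - l₀ ^ 2) /
      (α - 2 * l₀ + β⁻¹ * (b * ρ⁻¹ - ε))) : β * (b' + γ) + ε ≤ b := by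
  set B := β⁻¹ * (b * ρ⁻¹ - ε) with hB
  -- A zero denominator would give `b' = 0`, by the convention for division by zero, against `b' >
  -- 0`.
  have hden : α - 2 * l₀ + B ≠ 0 := by
    intro h
    rw [h, div_zero] at hb'
    linarith
  rw [eq_div_iff hden] at hb'
  -- The formula for `b'` is the identity `B(α - b' - γ) = (b' + γ)(α - b' - γ) + (b' + γ - l₀)²`,
  -- that is, the left-endpoint expression solved for `b'`.
  have h1 : (b' + γ) * (α - (b' + γ)) ≤ B * (α - (b' + γ)) := by
    nlinarith [sq_nonneg (b' + γ - l₀)]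
  have h2 : b' + γ ≤ B := le_of_mul_le_mul_right h1 (by linarith)
  have h3 : β * (b' + γ) ≤ b * ρ⁻¹ - ε := by
    have := mul_le_mul_of_nonneg_left h2 hβ.le
    rwa [hB, mul_inv_cancel_left₀ hβ.ne'] at this
  have h4 : 0 < β * (b' + γ) := mul_pos hβ (by linarith)
  have hρ' : 0 < ρ⁻¹ := inv_pos.2 (by linarith)
  have hb : 0 ≤ b := by
    by_contra hcon
    have := mul_neg_of_neg_of_pos (not_le.1 hcon) hρ'
    linarith
  have : b * ρ⁻¹ ≤ b := mul_le_of_le_one_right hb (inv_le_one_of_one_le₀ hρ.le)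
  linarith

end Endpoints

/-! ### The comparison theorem. -/

theorem theoremt
    {𝔄 H H₀ H₁ H₂ : Type*} [NonUnitalCStarAlgebra 𝔄]
    [NormedAddCommGroup H] [InnerProductSpace ℂ H] [CompleteSpace H]
    [NormedAddCommGroup H₀] [InnerProductSpace ℂ H₀] [CompleteSpace H₀]
    [NormedAddCommGroup H₁] [InnerProductSpace ℂ H₁] [CompleteSpace H₁]
    [NormedAddCommGroup H₂] [InnerProductSpace ℂ H₂] [CompleteSpace H₂]
    -- a faithful representation of the algebra and the unitary identifications
    (π : 𝔄 →⋆ₙₐ[ℂ] (H →L[ℂ] H)) (hπ : Function.Injective π)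
    (V₁ : H₁ ≃ₗᵢ[ℂ] H) (V₂ : H₂ ≃ₗᵢ[ℂ] H)
    -- the operators and the maps between the spaces
    (A₁ : H₁ →ₗ.[ℂ] H₁) (A₂ : H₂ →ₗ.[ℂ] H₂)
    (i₁ : H₀ →L[ℂ] H₁) (i₂ : H₀ →L[ℂ] H₂) (p₁ : H₁ →L[ℂ] H₀) (p₂ : H₂ →L[ℂ] H₀)
    (J : H₀ →L[ℂ] H₀) (J'₁ : H₁ →L[ℂ] H₁) (J'₂ : H₂ →L[ℂ] H₂)
    (l₀₁ l₀₂ γ₁ γ₂ α₁ α₂ β₁ β₂ ε₁ ε₂ ρ a₁ b₁ a₂ b₂ : ℝ)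
    (hl₀₁ : l₀₁ ≤ 0) (hl₀₂ : l₀₂ ≤ 0) (hα₁ : 0 < α₁) (hα₂ : 0 < α₂)
    (hβ₁ : 1 ≤ β₁) (hβ₂ : 1 ≤ β₂) (hε₁ : 0 < ε₁) (hε₂ : 0 < ε₂) (hρ : 1 < ρ)
    (hi₁ : Function.Injective i₁) (hi₂ : Function.Injective i₂)
    (hpi₁ : p₁ ∘L i₁ = ContinuousLinearMap.id ℂ H₀)
    (hpi₂ : p₂ ∘L i₂ = ContinuousLinearMap.id ℂ H₀)
    -- the cut-off operator `J` and its relation to the algebra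
    (hJ : IsSelfAdjoint J)
    (hJM : (V₂ : H₂ →L[ℂ] H) ∘L (i₂ ∘L J ∘L p₁) ∘L (V₁.symm : H →L[ℂ] H₁) ∈ bicommutant π)
    (hJadj : ContinuousLinearMap.adjoint (i₂ ∘L J ∘L p₁) = i₁ ∘L J ∘L p₂)
    (hJmul : ∀ a : 𝔄, ∃ b : 𝔄,
      π a ∘L ((V₂ : H₂ →L[ℂ] H) ∘L (i₂ ∘L J ∘L p₁) ∘L (V₁.symm : H →L[ℂ] H₁)) = π b)
    (hρJ : ∀ u : H₀, ρ⁻¹ * ‖i₂ (J u)‖ ≤ ‖i₁ (J u)‖ ∧ ‖i₁ (J u)‖ ≤ ρ * ‖i₂ (J u)‖)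
    (hD : ∀ u : H₀, i₁ (J u) ∈ A₁.domain ↔ i₂ (J u) ∈ A₂.domain)
    -- localization of both operators
    (hA₁ : IsCutoffLocalized A₁ (i₁ ∘L J ∘L p₁) J'₁ l₀₁ γ₁ α₁)
    (hA₂ : IsCutoffLocalized A₂ (i₂ ∘L J ∘L p₂) J'₂ l₀₂ γ₂ α₂)
    -- comparison of the quadratic forms
    (hA₂₁ : ∀ (u : H₀) (h₁ : i₁ (J u) ∈ A₁.domain) (h₂ : i₂ (J u) ∈ A₂.domain),
      (inner ℂ (A₂ ⟨i₂ (J u), h₂⟩) (i₂ (J u))).re ≤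
        β₁ * (inner ℂ (A₁ ⟨i₁ (J u), h₁⟩) (i₁ (J u))).re + ε₁ * ‖i₁ (J u)‖ ^ 2)
    (hA₁₂ : ∀ (u : H₀) (h₁ : i₁ (J u) ∈ A₁.domain) (h₂ : i₂ (J u) ∈ A₂.domain),
      (inner ℂ (A₁ ⟨i₁ (J u), h₁⟩) (i₁ (J u))).re ≤
        β₂ * (inner ℂ (A₂ ⟨i₂ (J u), h₂⟩) (i₂ (J u))).re + ε₂ * ‖i₂ (J u)‖ ^ 2)
    -- the heat operators belong to the algebra and have finite trace
    (hheat₁ : ∀ t : ℝ, 0 < t → ∃ (S : H₁ →L[ℂ] H₁) (s : 𝔄),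
      IsHeatOperator A₁ t S ∧ π s = unitaryTransport V₁ S)
    (hheat₂ : ∀ t : ℝ, 0 < t → ∃ (S : H₂ →L[ℂ] H₂) (s : 𝔄),
      IsHeatOperator A₂ t S ∧ π s = unitaryTransport V₂ S)
    (htrace : ∃ τ : (H →L[ℂ] H) → ℝ≥0∞,
      IsFaithfulNormalSemifiniteTrace (bicommutant π) τ ∧
      ∀ t : ℝ, 0 < t →
        (∀ S : H₁ →L[ℂ] H₁, IsHeatOperator A₁ t S → τ (unitaryTransport V₁ S) < ∞) ∧
        (∀ S : H₂ →L[ℂ] H₂, IsHeatOperator A₂ t S → τ (unitaryTransport V₂ S) < ∞))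
    -- the two intervals
    (hab₁ : a₁ < b₁)
    (ha₂ : a₂ = ρ * (β₁ * (a₁ + γ₁ + (a₁ + γ₁ - l₀₁) ^ 2 / (α₁ - a₁ - γ₁)) + ε₁))
    (hb₂ : b₂ = (β₂⁻¹ * (b₁ * ρ⁻¹ - ε₂) * (α₂ - γ₂) - α₂ * γ₂ + 2 * l₀₂ * γ₂ - l₀₂ ^ 2) /
      (α₂ - 2 * l₀₂ + β₂⁻¹ * (b₁ * ρ⁻¹ - ε₂)))
    (haα₁ : a₁ + γ₁ < α₁) (hbα₂ : b₂ + γ₂ < α₂) (hab₂ : a₂ < b₂)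
    (ha₂_nonneg : 0 ≤ a₂)
    (hgap : ∀ x : ℝ, a₁ < x → x < b₁ → (x : ℂ) ∉ unboundedSpectrum A₁) :
    (∀ x : ℝ, a₂ < x → x < b₂ → (x : ℂ) ∉ unboundedSpectrum A₂) ∧
    ∀ l₁ l₂ : ℝ, a₁ < l₁ → l₁ < b₁ → a₂ < l₂ → l₂ < b₂ →
      ∃ (E₁ : H₁ →L[ℂ] H₁) (E₂ : H₂ →L[ℂ] H₂) (e₁ e₂ : 𝔄),
        IsSpectralProjection A₁ l₁ E₁ ∧ IsSpectralProjection A₂ l₂ E₂ ∧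
        π e₁ = unitaryTransport V₁ E₁ ∧ π e₂ = unitaryTransport V₂ E₂ ∧
        MurrayVonNeumannEquiv e₁ e₂ := by
  obtain ⟨S₁, s₁, hS₁, hs₁⟩ := hheat₁ 1 one_pos
  obtain ⟨S₂, s₂, hS₂, hs₂⟩ := hheat₂ 1 one_pos
  obtain ⟨τ, hτ, hτfin⟩ := htrace
  have hτ₁ := (hτfin 1 one_pos).1 S₁ hS₁
  obtain ⟨P₁, μ₁, hP₁, hS₁⟩ := hS₁.exists_resolution
  obtain ⟨P₂, μ₂, hP₂, hS₂⟩ := hS₂.exists_resolution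
  rw [unitaryTransport_eq_conj] at hs₁ hs₂ hτ₁
  have hgap₁ : P₁ (Set.Ioo a₁ b₁) = 0 :=
    hP₁.apply_Ioo_eq_zero_of_resolvent hA₁.selfAdjoint fun x hx hx' => not_not.1 (hgap x hx hx')
  -- the intertwiners satisfy `‖X u‖ = ‖J₁ u‖` and `‖Y u‖ = ‖J₂ u‖`, whatever `ρ` is
  set X : H₁ →L[ℂ] H₂ := i₂ ∘L J ∘L p₁ with hX
  set Y : H₂ →L[ℂ] H₁ := i₁ ∘L J ∘L p₂ with hY
  have hp₁ : ∀ u, p₁ (i₁ u) = u := fun u => congrArg (fun T : H₀ →L[ℂ] H₀ => T u) hpi₁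
  have hp₂ : ∀ u, p₂ (i₂ u) = u := fun u => congrArg (fun T : H₀ →L[ℂ] H₀ => T u) hpi₂
  have hXn : ∀ u, ‖X u‖ = ‖(i₁ ∘L J ∘L p₁) u‖ :=
    norm_apply_eq_of_adjoint_comp hJadj hA₁.cutoff_selfAdjoint fun u => by simp [hX, hY, hp₁, hp₂]
  have hYn : ∀ u, ‖Y u‖ = ‖(i₂ ∘L J ∘L p₂) u‖ :=
    norm_apply_eq_of_adjoint_comp (by rw [← hJadj, ContinuousLinearMap.adjoint_adjoint])
      hA₂.cutoff_selfAdjoint fun u => by simp [hX, hY, hp₁, hp₂]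
  have hbound₁ : β₁ * (a₁ + γ₁) + ε₁ ≤ a₂ :=
    le_left_endpoint (by linarith) hρ.le (by linarith) ha₂ ha₂_nonneg
  have hbound₂ : β₂ * (b₂ + γ₂) + ε₂ ≤ b₁ :=
    right_endpoint_le (by linarith) hρ hε₂.le hA₂.gamma_nonneg (by linarith) hbα₂ hb₂
  -- Only the gap of `A₁` enters here, so this serves twice: in the bicommutant, to find the gap of
  -- `A₂`, and then in `𝔄`.
  have key : ∀ l₁ l₂ : ℝ, a₁ < l₁ → l₁ < b₁ → a₂ < l₂ → l₂ < b₂ →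
      ∃ g : ℝ → ℝ, Continuous g ∧ g 0 = 0 ∧ ∀ T : H →L[ℂ] H,
        T = V₂.conjStarAlgEquiv (P₂ (Set.Iic l₂)) *
          ((V₂ : H₂ →L[ℂ] H) ∘L X ∘L (V₁.symm : H →L[ℂ] H₁)) *
          V₁.conjStarAlgEquiv (P₁ (Set.Iic l₁)) →
        star (T * cfcₙ g (star T * T)) * (T * cfcₙ g (star T * T)) =
          V₁.conjStarAlgEquiv (P₁ (Set.Iic l₁)) ∧
        (T * cfcₙ g (star T * T)) * star (T * cfcₙ g (star T * T)) =
          V₂.conjStarAlgEquiv (P₂ (Set.Iic l₂)) := by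
    intro l₁ l₂ h1 h2 h3 h4
    have hpos₁ : 0 < (l₂ - (β₁ * (a₁ + γ₁) + ε₁)) * (α₁ - (a₁ + γ₁)) :=
      mul_pos (by linarith) (by linarith)
    have hpos₂ : 0 < (l₂ - l₀₂) * (α₁ - l₀₁) := mul_pos (by linarith) (by linarith)
    have hβl : β₂ * (l₂ + γ₂) < β₂ * (b₂ + γ₂) :=
      mul_lt_mul_of_pos_left (by linarith) (by linarith)
    have hbelow : ∀ u, P₁ (Set.Iic l₁) u = u →
        (l₂ - (β₁ * (a₁ + γ₁) + ε₁)) * (α₁ - (a₁ + γ₁)) / ((l₂ - l₀₂) * (α₁ - l₀₁)) * ‖u‖ ^ 2 ≤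
          ‖P₂ (Set.Iic l₂) (X u)‖ ^ 2 := by
      intro u hu
      rw [div_mul_eq_mul_div, div_le_iff₀ hpos₂, mul_comm (‖_‖ ^ 2)]
      -- The gap lowers the energy bound from `l₁` to `a₁`, which is the level for which `a₂` is
      -- designed.
      have hu' : P₁ (Set.Iic a₁) u = u := by rw [← hP₁.apply_Iic_of_gap h1 h2 hgap₁, hu]
      have hud := hP₁.mem_domain_of_apply_Iic hS₁ hu
      refine hA₁.le_norm_sq_apply hP₂ hA₂.semibounded hXn
        (fun v hv => (hD (p₁ v)).1 hv) (by linarith) (fun v hv₁ hv₂ => hA₂₁ (p₁ v) hv₁ hv₂) haα₁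
        (by linarith) measurableSet_Iic (fun w => ?_) ⟨u, hud⟩
        (hP₁.form_le measurableSet_Iic ⟨u, hud⟩ hu' fun x hx => hx)
      rw [hP₂.apply_apply measurableSet_Ici measurableSet_Iic.compl, Set.compl_Iic,
        Set.inter_eq_right.2 Set.Ioi_subset_Ici_self]
    have hinj : ∀ v, P₂ (Set.Iic l₂) v = v →
        P₁ (Set.Iic l₁) (ContinuousLinearMap.adjoint X v) = 0 → v = 0 := by
      intro v hv hv0
      have hvd := hP₂.mem_domain_of_apply_Iic hS₂ hv
      -- In the other direction the gap raises the threshold: the complement of `(-∞, l₁]` has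
      -- energy at least `b₁ > β₂(l₂ + γ₂) + ε₂`.
      have := hA₂.le_norm_sq_apply hP₁ hA₁.semibounded hYn
        (fun v hv => (hD (p₂ v)).2 hv) (by linarith) (fun v hv₁ hv₂ => hA₁₂ (p₂ v) hv₂ hv₁)
        (l := l₂) (m' := b₁) (by linarith) (by linarith) (measurableSet_Iic (a := l₁))
        (hP₁.apply_Ici_compl_of_gap h1 h2 hgap₁) ⟨v, hvd⟩
        (hP₂.form_le measurableSet_Iic ⟨v, hvd⟩ hv fun x hx => hx)
      simp only at this
      rw [← hJadj, hv0, norm_zero] at this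
      have hpos : 0 < (b₁ - (β₂ * (l₂ + γ₂) + ε₂)) * (α₂ - (l₂ + γ₂)) :=
        mul_pos (by linarith) (by linarith)
      have h0 : ‖v‖ ^ 2 ≤ 0 := by
        by_contra hcon
        have := mul_pos hpos (not_le.1 hcon)
        linarith
      simpa using le_antisymm h0 (sq_nonneg _)
    obtain ⟨g, hg, hg0, hgE, hgF⟩ := exists_partial_isometry_conj V₁ V₂ X
      (hP₁.isStarProjection _ (measurableSet_Iic (a := l₁)))
      (hP₂.isStarProjection _ (measurableSet_Iic (a := l₂))) (div_pos hpos₁ hpos₂) hbelow hinj rfl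
    exact ⟨g, hg, hg0, fun T hT => by rw [hT]; exact ⟨hgE, hgF⟩⟩
  -- A fixed reference level in the gap of `A₁`, with which all projections of `A₂` at levels in
  -- `(a₂, b₂)` are compared.
  obtain ⟨l₁', hl₁', hl₁''⟩ := exists_between hab₁
  have htr : ∀ l₂ : ℝ, a₂ < l₂ → l₂ < b₂ → τ (V₂.conjStarAlgEquiv (P₂ (Set.Iic l₂))) =
      τ (V₁.conjStarAlgEquiv (P₁ (Set.Iic l₁'))) := by
    intro l₂ h3 h4
    obtain ⟨g, -, -, h⟩ := key l₁' l₂ hl₁' hl₁'' h3 h4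
    have hT := mul_mem (mul_mem (hP₂.conj_apply_Iic_mem_bicommutant hS₂ hs₂ l₂) hJM)
      (hP₁.conj_apply_Iic_mem_bicommutant hS₁ hs₁ l₁')
    obtain ⟨hE, hF⟩ := h _ rfl
    generalize V₂.conjStarAlgEquiv (P₂ (Set.Iic l₂)) *
      ((V₂ : H₂ →L[ℂ] H) ∘L X ∘L (V₁.symm : H →L[ℂ] H₁)) *
      V₁.conjStarAlgEquiv (P₁ (Set.Iic l₁')) = T at hE hF hT
    rw [← hE, ← hF]
    exact (hτ.tracial _ (mul_mem hT (cfcₙ_mem_bicommutant (mul_mem (star_mem hT) hT) g))).symm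
  have hgap₂ : ∀ l l' : ℝ, a₂ < l → l < l' → l' < b₂ → P₂ (Set.Ioc l l') = 0 := by
    intro l l' h1 h2 h3
    refine hP₂.apply_Ioc_eq_zero_of_trace_eq hS₂ hs₂ hτ h2.le ?_ ?_
    · rw [htr l h1 (h2.trans h3)]
      exact hP₁.trace_conj_apply_Iic_lt_top hS₁ hs₁ hτ hτ₁ l₁'
    · rw [htr l h1 (h2.trans h3), htr l' (h1.trans h2) h3]
  refine ⟨fun x hx hx' => not_not.2 ?_, fun l₁ l₂ h1 h2 h3 h4 => ?_⟩
  · obtain ⟨l, hl, hl'⟩ := exists_between hx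
    obtain ⟨m, hm, hm'⟩ := exists_between hx'
    exact hP₂.isResolventPoint_of_gap hA₂.selfAdjoint hl' hm (hgap₂ l m hl (hl'.trans hm) hm')
  · obtain ⟨e₁, he₁⟩ := hP₁.exists_preimage_conj_apply_Iic hS₁ hπ hs₁ h2 (by
      have h0 := hP₁.inter (Set.Ioo l₁ b₁) (Set.Ioo a₁ b₁) measurableSet_Ioo measurableSet_Ioo
      rwa [hgap₁, mul_zero, Set.inter_eq_left.2 (Set.Ioo_subset_Ioo_left h1.le)] at h0)
    obtain ⟨m, hm, hm'⟩ := exists_between h4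
    obtain ⟨e₂, he₂⟩ := hP₂.exists_preimage_conj_apply_Iic hS₂ hπ hs₂ hm (by
      have h0 := hP₂.inter (Set.Ioo l₂ m) (Set.Ioc l₂ m) measurableSet_Ioo measurableSet_Ioc
      rwa [hgap₂ l₂ m h3 hm hm', mul_zero, Set.inter_eq_left.2 Set.Ioo_subset_Ioc_self] at h0)
    -- The transported `X` need not lie in `π(𝔄)`, but its product with `π e₂` does; thus `b * e₁`
    -- represents `T`.
    obtain ⟨b, hb⟩ := hJmul e₂
    obtain ⟨g, hg, hg0, h⟩ := key l₁ l₂ h1 h2 h3 h4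
    have ht : π (b * e₁) = V₂.conjStarAlgEquiv (P₂ (Set.Iic l₂)) *
        ((V₂ : H₂ →L[ℂ] H) ∘L X ∘L (V₁.symm : H →L[ℂ] H₁)) *
        V₁.conjStarAlgEquiv (P₁ (Set.Iic l₁)) := by
      rw [map_mul, ← hb, he₁, ← he₂]; rfl
    obtain ⟨hE, hF⟩ := h _ ht
    generalize b * e₁ = t at ht hE hF
    have hv : π (t * cfcₙ g (star t * t)) = π t * cfcₙ g (star (π t) * π t) := by
      rw [map_mul, map_cfcₙ_of_isSelfAdjoint π hg hg0 (IsSelfAdjoint.star_mul_self t), map_mul,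
        map_star]
    refine ⟨P₁ (Set.Iic l₁), P₂ (Set.Iic l₂), e₁, e₂, ⟨P₁, μ₁, hP₁, rfl⟩, ⟨P₂, μ₂, hP₂, rfl⟩,
      he₁, he₂, IsStarProjection.of_map_injective hπ ?_, IsStarProjection.of_map_injective hπ ?_,
      t * cfcₙ g (star t * t), hπ ?_, hπ ?_⟩
    · rw [he₁]; exact (hP₁.isStarProjection _ measurableSet_Iic).map _
    · rw [he₂]; exact (hP₂.isStarProjection _ measurableSet_Iic).map _
    · rw [map_mul, map_star, hv, hE, he₁]
    · rw [map_mul, map_star, hv, hF, he₂]
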